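/- **Setting.** Let $V\subset\mathbb R^2$ be a non-empty connected open set. Subscripts $x,y,z$ denote partial derivatives, $L\varphi:=\varphi_{xx}-\varphi_{yy}$, and likewise $L\psi$. *The class $Met^0$.* Let $\hat g=E\,dx^2+G\,dy^2$ be an analytic Riemannian metric on $V$ of constant Gauss curvature $-1$. A quadruple of analytic functions $(\varphi,\varphi_z,\psi,\psi_z)$ on $V$ (four independent functions; $\varphi_z,\psi_z$ are regarded as initial values of $z$-derivatives) with $\varphi_z\sin\varphi\cos\varphi\ne0$ is *determined by* $\hat g$ if $$E=A^2,\quad G=B^2,\qquad A:=-\frac{\varphi_{zx}}{\varphi_z\sin\varphi}=\frac{\psi_{zx}}{\varphi_z\cos\varphi},\qquad B:=\frac{\varphi_{zy}}{\varphi_z\cos\varphi}=\frac{\psi_{zy}}{\varphi_z\sin\varphi},$$ and if, with $\varphi_{zz}:=L\varphi\cos2\varphi+L\psi\sin2\varphi$ and $\psi_{zz}:=L\varphi\sin2\varphi-L\psi\cos2\varphi$, $$(\psi_{zz})_x+(\varphi_{zz})_x\cot\varphi-\frac{\varphi_z\varphi_{zx}}{\sin^2\varphi}=0,\qquad(\psi_{zz})_y-(\varphi_{zz})_y\tan\varphi-\frac{\varphi_z\varphi_{zy}}{\cos^2\varphi}=0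 .$$ The pair $(\varphi,\varphi_z)$ *arises from* $\hat g$ if for every $t\neq0$ the pair $(\varphi,t\varphi_z)$ can be completed by some $\psi,\psi_z$ to a quadruple determined by $\hat g$; $\hat g$ belongs to $Met^0$ if some pair arises from it. *The system for $(\bar P,\bar P_z)$.* Let $(\varphi,\varphi_z,\psi,\psi_z)$ be determined by $\hat g\in Met^0$, with $(\varphi,\varphi_z)$ arising from $\hat g$. For analytic functions $\bar P,\bar P_z$ on $V$ (independent of each other) put $h:=e^{-\bar P}$, $h_z:=-e^{-\bar P}\bar P_z$, $$\bar\kappa_3:=\Big(\tan\varphi\,h_{xx}-\varphi_x\tfrac{\cos2\varphi}{\cos^2\varphi}h_x\Big)-\Big(\cot\varphi\,h_{yy}-\varphi_y\tfrac{\cos2\varphi}{\sin^2\varphi}h_y\Big)+h\varphi_{zz}-h_z\varphi_z,$$ $$\bar\kappa_1:=h\tan\varphi+\bar\kappa_3,\qquad\bar\kappa_2:=-h\cot\varphi+\bar\kappa_3,$$ $$h_{zz}:=(h_{xx}+2\varphi_x\tan\varphi\,h_x)+(h_{yy}-2\varphi_y\cot\varphi\,h_y)+(1-2\psi_{zz})h,$$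 $$\bar\zeta:=h\big[(h_{xx}+2\varphi_x\tan\varphi\,h_x)+(h_{yy}-2\varphi_y\cot\varphi\,h_y)+(h_{zz}+\varphi_z^2h)\big]-\Big(\tfrac{h_x^2}{\cos^2\varphi}+\tfrac{h_y^2}{\sin^2\varphi}+h_z^2\Big).$$ The system is $$h_{xy}-h_y\varphi_x\cot\varphi+h_x\varphi_y\tan\varphi=0,\qquad (h_z)_x+h_x\varphi_z\tan\varphi-h\varphi_{zx}\cot\varphi=0,$$ $$(h_z)_y-h_y\varphi_z\cot\varphi+h\varphi_{zy}\tan\varphi=0,\qquad \bar\kappa_3^2=\bar\zeta .\tag{S}$$ *Special metrics.* $\hat g$ with $(\varphi,\varphi_z)$ is *special* if, for some $t\ne0$ and analytic one-variable functions $\rho(y)$ and $\sigma(x)>0$ with nowhere vanishing derivatives, $\varphi$ is a function of $y$ alone and $$\cos^2\varphi=\frac1{1+e^{2\rho(y)}},\quad\sin^2\varphi=\frac{e^{2\rho(y)}}{1+e^{2\rho(y)}},\quad \varphi_z=t\,\sigma(x)\sin\varphi,\quad \hat g=\Big(\frac{\sigma'}{\sigma}\Big)^2(1+e^{-2\rho})\,dx^2+\frac{\rho'^2}{1+e^{2\rho}}\,dy^2,$$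 or if the same holds after exchanging $x$ with $y$ and $\varphi$ with $\pi/2-\varphi$. For one-variable $\varphi$ the conditions above fix $L\psi$ only up to one constant of integration. The potential *belonging to* a special metric is the one with $$L\psi=\tfrac12\Big[\frac{\varphi_z^2}{\sin^2\varphi}-\frac{\varphi_y^2}{\cos^2\varphi}\Big]-\varphi_{yy}\tan\varphi\quad(\varphi=\varphi(y)),\qquad L\psi=-\tfrac12\Big[\frac{\varphi_z^2}{\cos^2\varphi}-\frac{\varphi_x^2}{\sin^2\varphi}\Big]-\varphi_{xx}\cot\varphi\quad(\varphi=\varphi(x)).$$ *Guichard nets and $\Xi_g$.* Let $V'\subseteq V$ be open and non-empty and $I\ni0$ an open interval. A *Guichard net arising from* the quadruple on $V'\times I$ is an analytic conformally flat Riemannian metric $g=\cos^2\varphi\,dx^2+\sin^2\varphi\,dy^2+dz^2$, $\varphi=\varphi(x,y,z)$, with $\varphi_z\varphi_{xz}\varphi_{yz}\neq0$ everywhere, such that for some analytic $\psi(x,y,z)$ $$\psi_{zz}=(\varphi_{xx}-\varphi_{yy})\sin2\varphi-(\psi_{xx}-\psi_{yy})\cos2\varphi,\qquad\varphi_{zz}=(\varphi_{xx}-\varphi_{yy})\cos2\varphi+(\psi_{xx}-\psi_{yy})\sin2\varphi,$$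 and $(\varphi,\varphi_z,\psi,\psi_z)$ at $z=0$ is the given quadruple. For such $g$, $\Xi_g$ is the set of positive smooth functions $h=e^{-P}$ on $V'\times I$ which satisfy there the three differential equations $$h_{xy}-h_y\varphi_x\cot\varphi+h_x\varphi_y\tan\varphi=h_{zx}+h_x\varphi_z\tan\varphi-h\varphi_{zx}\cot\varphi=h_{zy}-h_y\varphi_z\cot\varphi+h\varphi_{zy}\tan\varphi=0,$$ the evolution equation $$h_{zz}=(h_{xx}+2\varphi_x\tan\varphi\,h_x)+(h_{yy}-2\varphi_y\cot\varphi\,h_y)+\Big(1-2\,\frac{\varphi_{xx}-\varphi_{yy}-\varphi_{zz}\cos2\varphi}{\sin2\varphi}\Big)h,$$ and $\zeta=\kappa_3^2$, where $\kappa_3,\zeta$ are given by the formulas for $\bar\kappa_3,\bar\zeta$ with the functions of $(x,y,z)$ and their actual $z$-derivatives. **Proposition 3.3.** Let $\hat g\in Met^0$, let $(\varphi,\varphi_z,\psi,\psi_z)$ be a quadruple on $V$ determined by $\hat g$ with $(\varphi,\varphi_z)$ arising from $\hat g$, and suppose that analytic functions $(\bar P,\bar P_z)$ on $V$ solve (S)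 and satisfy $\bar\kappa_1\bar\kappa_2\equiv0$ on $V$. 1. Then $\hat g$ with $(\varphi,\varphi_z)$ is special; in particular $\varphi(x,y)$ depends on one variable only. 2. However, if $\psi$ is the potential belonging to the special metric, then for every non-empty open $V'\subseteq V$, every open interval $I\ni0$ and every Guichard net $g$ on $V'\times I$ arising from the quadruple, there is no $e^{-P}\in\Xi_g$ such that $e^{-P}(x,y,0)=e^{-\bar P}(x,y)$ and $(e^{-P})_z(x,y,0)=-(e^{-\bar P}\bar P_z)(x,y)$ on $V'$. -/

import Mathlib

open Real Set
open scoped ContDiff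

noncomputable section

namespace GuichardNet

/-! ### Partial derivatives

Points of the `(x, y)`-plane are elements of `ℝ × ℝ`; points of `(x, y, z)`-space are elements
`((x, y), z)` of `(ℝ × ℝ) × ℝ`. -/

/-- `∂f/∂x` for a function of `(x, y)`. -/
def dx (f : ℝ × ℝ → ℝ) : ℝ × ℝ → ℝ := fun p => fderiv ℝ f p (1, 0)

/-- `∂f/∂y` for a function of `(x, y)`. -/
def dy (f : ℝ × ℝ → ℝ) : ℝ × ℝ → ℝ := fun p => fderiv ℝ f p (0, 1)

/-- `∂f/∂x` for a function of `(x, y, z)`. -/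
def Dx (f : (ℝ × ℝ) × ℝ → ℝ) : (ℝ × ℝ) × ℝ → ℝ := fun q => fderiv ℝ f q ((1, 0), 0)

/-- `∂f/∂y` for a function of `(x, y, z)`. -/
def Dy (f : (ℝ × ℝ) × ℝ → ℝ) : (ℝ × ℝ) × ℝ → ℝ := fun q => fderiv ℝ f q ((0, 1), 0)

/-- `∂f/∂z` for a function of `(x, y, z)`. -/
def Dz (f : (ℝ × ℝ) × ℝ → ℝ) : (ℝ × ℝ) × ℝ → ℝ := fun q => fderiv ℝ f q ((0, 0), 1)

/-! ### Orthogonal 2-metrics `E dx² + G dy²` of Gauss curvature `-1` -/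

/-- The Gauss curvature of the orthogonal metric `E dx² + G dy²`. -/
def gaussCurvature (E G : ℝ × ℝ → ℝ) (p : ℝ × ℝ) : ℝ :=
  -(1 / (2 * √(E p * G p))) *
    (dx (fun r => dx G r / √(E r * G r)) p + dy (fun r => dy E r / √(E r * G r)) p)

/-- `E dx² + G dy²` is an analytic Riemannian metric on `V` of constant Gauss curvature `-1`. -/
structure IsHyperbolicMetric (V : Set (ℝ × ℝ)) (E G : ℝ × ℝ → ℝ) : Prop where
  analytic_E : AnalyticOnNhd ℝ E V
  analytic_G : AnalyticOnNhd ℝ G V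
  pos_E : ∀ p ∈ V, 0 < E p
  pos_G : ∀ p ∈ V, 0 < G p
  curvature : ∀ p ∈ V, gaussCurvature E G p = -1

/-! ### Initial data determined by a 2-metric, and the class `Met⁰` -/

/-- Four functions `φ`, `φ_z`, `ψ`, `ψ_z` on a plane domain: initial values on `z = 0` of two
functions `φ(x, y, z)`, `ψ(x, y, z)` and of their `z`-derivatives. -/
structure InitialData where
  φ : ℝ × ℝ → ℝ
  φz : ℝ × ℝ → ℝ
  ψ : ℝ × ℝ → ℝ
  ψz : ℝ × ℝ → ℝ

namespace InitialData

/-- `Lφ = φ_xx - φ_yy`. -/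
def Lφ (d : InitialData) (p : ℝ × ℝ) : ℝ := dx (dx d.φ) p - dy (dy d.φ) p

/-- `Lψ = ψ_xx - ψ_yy`. -/
def Lψ (d : InitialData) (p : ℝ × ℝ) : ℝ := dx (dx d.ψ) p - dy (dy d.ψ) p

/-- `φ_zz` on `z = 0`, as prescribed by the evolution equations. -/
def φzz (d : InitialData) (p : ℝ × ℝ) : ℝ :=
  d.Lφ p * cos (2 * d.φ p) + d.Lψ p * sin (2 * d.φ p)

/-- `ψ_zz` on `z = 0`, as prescribed by the evolution equations. -/
def ψzz (d : InitialData) (p : ℝ × ℝ) : ℝ :=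
  d.Lφ p * sin (2 * d.φ p) - d.Lψ p * cos (2 * d.φ p)

end InitialData

/-- `(φ, φ_z, ψ, ψ_z)` is a class of functions on `V` determined by the 2-metric
`E dx² + G dy²`: with `A = -φ_zx / (φ_z sin φ)` and `B = φ_zy / (φ_z cos φ)` the metric is
`A² dx² + B² dy²`, moreover `A = ψ_zx / (φ_z cos φ)` and `B = ψ_zy / (φ_z sin φ)`, and the
`z`-derivatives of `ψ_xz + φ_xz cot φ` and of `ψ_yz - φ_yz tan φ` vanish on `z = 0`. -/
structure IsDeterminedBy (V : Set (ℝ × ℝ)) (E G : ℝ × ℝ → ℝ) (d : InitialData) : Prop where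
  analytic_φ : AnalyticOnNhd ℝ d.φ V
  analytic_φz : AnalyticOnNhd ℝ d.φz V
  analytic_ψ : AnalyticOnNhd ℝ d.ψ V
  analytic_ψz : AnalyticOnNhd ℝ d.ψz V
  sin_ne : ∀ p ∈ V, sin (d.φ p) ≠ 0
  cos_ne : ∀ p ∈ V, cos (d.φ p) ≠ 0
  φz_ne : ∀ p ∈ V, d.φz p ≠ 0
  metric_x : ∀ p ∈ V, E p = (-(dx d.φz p) / (d.φz p * sin (d.φ p))) ^ 2
  metric_y : ∀ p ∈ V, G p = (dy d.φz p / (d.φz p * cos (d.φ p))) ^ 2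
  ψz_x : ∀ p ∈ V, dx d.ψz p / (d.φz p * cos (d.φ p)) = -(dx d.φz p) / (d.φz p * sin (d.φ p))
  ψz_y : ∀ p ∈ V, dy d.ψz p / (d.φz p * sin (d.φ p)) = dy d.φz p / (d.φz p * cos (d.φ p))
  compat_x : ∀ p ∈ V, dx d.ψzz p + dx d.φzz p * cot (d.φ p)
    - dx d.φz p * (d.φz p / sin (d.φ p) ^ 2) = 0
  compat_y : ∀ p ∈ V, dy d.ψzz p - dy d.φzz p * tan (d.φ p)
    - dy d.φz p * (d.φz p / cos (d.φ p) ^ 2) = 0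

/-- `(φ, φ_z)` generates a one-parameter family `(φ, t φ_z)`, `t ≠ 0`, each member of which extends
to a class determined by `E dx² + G dy²`. -/
def GeneratesFamily (V : Set (ℝ × ℝ)) (E G φ φz : ℝ × ℝ → ℝ) : Prop :=
  ∀ t : ℝ, t ≠ 0 → ∃ ψ ψz : ℝ × ℝ → ℝ, IsDeterminedBy V E G ⟨φ, fun p => t * φz p, ψ, ψz⟩

/-- The 2-metric `E dx² + G dy²` on `V` belongs to `Met⁰`. -/
def MemMetZero (V : Set (ℝ × ℝ)) (E G : ℝ × ℝ → ℝ) : Prop :=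
  IsHyperbolicMetric V E G ∧ ∃ φ φz : ℝ × ℝ → ℝ, GeneratesFamily V E G φ φz

/-- The functions `(φ, φ_z)`, together with the `(ψ, ψ_z)` belonging to them, arise from the 2-metric
`E dx² + G dy²`. The parameter `t` is absorbed in `φ_z`. -/
def ArisesFrom (V : Set (ℝ × ℝ)) (E G : ℝ × ℝ → ℝ) (d : InitialData) : Prop :=
  IsDeterminedBy V E G d ∧ GeneratesFamily V E G d.φ d.φz

/-- The 2-metric `E dx² + G dy²` is one of the special metrics, `φ` being a function of `y` alone
with `cos² φ = 1 / (1 + e^{2ρ})`, `sin² φ = e^{2ρ} / (1 + e^{2ρ})` and `φ_z = t σ(x) sin φ`. Here `ρ`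
is a function of `y`, `σ > 0` is a function of `x`, both with nowhere vanishing derivative. -/
def IsSpecialY (V : Set (ℝ × ℝ)) (E G φ φz : ℝ × ℝ → ℝ) : Prop :=
  ∃ (θ ρ σ : ℝ → ℝ) (t : ℝ), t ≠ 0 ∧
    AnalyticOnNhd ℝ θ (Prod.snd '' V) ∧
    AnalyticOnNhd ℝ ρ (Prod.snd '' V) ∧ (∀ y ∈ Prod.snd '' V, deriv ρ y ≠ 0) ∧
    AnalyticOnNhd ℝ σ (Prod.fst '' V) ∧ (∀ x ∈ Prod.fst '' V, 0 < σ x ∧ deriv σ x ≠ 0) ∧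
    ∀ p ∈ V,
      φ p = θ p.2 ∧
      cos (φ p) ^ 2 = 1 / (1 + exp (2 * ρ p.2)) ∧
      sin (φ p) ^ 2 = exp (2 * ρ p.2) / (1 + exp (2 * ρ p.2)) ∧
      φz p = t * σ p.1 * sin (φ p) ∧
      E p = (deriv σ p.1 / σ p.1) ^ 2 * (1 + exp (-(2 * ρ p.2))) ∧
      G p = deriv ρ p.2 ^ 2 / (1 + exp (2 * ρ p.2))

/-- The same as `IsSpecialY` with the roles of `x` and `y` exchanged: this replaces `φ` by
`π / 2 - φ` and exchanges the two coefficients of the metric. -/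
def IsSpecialX (V : Set (ℝ × ℝ)) (E G φ φz : ℝ × ℝ → ℝ) : Prop :=
  ∃ (θ ρ σ : ℝ → ℝ) (t : ℝ), t ≠ 0 ∧
    AnalyticOnNhd ℝ θ (Prod.fst '' V) ∧
    AnalyticOnNhd ℝ ρ (Prod.fst '' V) ∧ (∀ x ∈ Prod.fst '' V, deriv ρ x ≠ 0) ∧
    AnalyticOnNhd ℝ σ (Prod.snd '' V) ∧ (∀ y ∈ Prod.snd '' V, 0 < σ y ∧ deriv σ y ≠ 0) ∧
    ∀ p ∈ V,
      φ p = θ p.1 ∧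
      sin (φ p) ^ 2 = 1 / (1 + exp (2 * ρ p.1)) ∧
      cos (φ p) ^ 2 = exp (2 * ρ p.1) / (1 + exp (2 * ρ p.1)) ∧
      φz p = t * σ p.2 * cos (φ p) ∧
      G p = (deriv σ p.2 / σ p.2) ^ 2 * (1 + exp (-(2 * ρ p.1))) ∧
      E p = deriv ρ p.1 ^ 2 / (1 + exp (2 * ρ p.1))

/-- For one-variable `φ` the differential conditions on `ψ` leave one constant of integration in
`Lψ` undetermined. The function `ψ` belonging to the special metrics is the one with
`Lψ = ½ (σ² - φ_y² / cos² φ) - φ_yy tan φ`, where `σ = φ_z / sin φ`, if `φ` depends on `y` only;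
exchanging `x` and `y` (hence `φ` and `π / 2 - φ`) gives the formula for `φ` depending on
`x` only. -/
structure IsSpecialPotential (V : Set (ℝ × ℝ)) (d : InitialData) : Prop where
  of_y : (∀ p ∈ V, dx d.φ p = 0) → ∀ p ∈ V,
    d.Lψ p = (1 / 2) * ((d.φz p / sin (d.φ p)) ^ 2 - dy d.φ p ^ 2 / cos (d.φ p) ^ 2)
      - dy (dy d.φ) p * tan (d.φ p)
  of_x : (∀ p ∈ V, dy d.φ p = 0) → ∀ p ∈ V,
    d.Lψ p = -((1 / 2) * ((d.φz p / cos (d.φ p)) ^ 2 - dx d.φ p ^ 2 / sin (d.φ p) ^ 2))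
      - dx (dx d.φ) p * cot (d.φ p)

/-! ### The system for the pair `(P, P_z)` on the plane domain -/

/-- The initial values `e^{-P}` and `(e^{-P})_z = -e^{-P} P_z`. -/
def expNeg (P : ℝ × ℝ → ℝ) : ℝ × ℝ → ℝ := fun p => exp (-P p)

/-- See `expNeg`. -/
def expNegZ (P Pz : ℝ × ℝ → ℝ) : ℝ × ℝ → ℝ := fun p => -(exp (-P p) * Pz p)

/-- `ψ_zz = (φ_xx - φ_yy - φ_zz cos 2φ) / sin 2φ`. -/
def barPsiZZ (d : InitialData) (p : ℝ × ℝ) : ℝ :=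
  (dx (dx d.φ) p - dy (dy d.φ) p - d.φzz p * cos (2 * d.φ p)) / sin (2 * d.φ p)

/-- The function `κ̄₃` made from `h = e^{-P}` and `k = (e^{-P})_z`. -/
def barKappa3 (d : InitialData) (h k : ℝ × ℝ → ℝ) (p : ℝ × ℝ) : ℝ :=
  (tan (d.φ p) * dx (dx h) p - dx d.φ p * (cos (2 * d.φ p) / cos (d.φ p) ^ 2) * dx h p)
  - (cot (d.φ p) * dy (dy h) p - dy d.φ p * (cos (2 * d.φ p) / sin (d.φ p) ^ 2) * dy h p)
  + (h p * d.φzz p - k p * d.φz p)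

/-- `κ̄₁ = e^{-P} tan φ + κ̄₃`. -/
def barKappa1 (d : InitialData) (h k : ℝ × ℝ → ℝ) (p : ℝ × ℝ) : ℝ :=
  h p * tan (d.φ p) + barKappa3 d h k p

/-- `κ̄₂ = -e^{-P} cot φ + κ̄₃`. -/
def barKappa2 (d : InitialData) (h k : ℝ × ℝ → ℝ) (p : ℝ × ℝ) : ℝ :=
  -(h p * cot (d.φ p)) + barKappa3 d h k p

/-- The function `(e^{-P})_zz` made from `h = e^{-P}`. -/
def barHZZ (d : InitialData) (h : ℝ × ℝ → ℝ) (p : ℝ × ℝ) : ℝ :=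
  (dx (dx h) p + 2 * dx d.φ p * tan (d.φ p) * dx h p)
  + (dy (dy h) p - 2 * dy d.φ p * cot (d.φ p) * dy h p)
  + (1 - 2 * barPsiZZ d p) * h p

/-- The function `ζ̄`. -/
def barZeta (d : InitialData) (h k : ℝ × ℝ → ℝ) (p : ℝ × ℝ) : ℝ :=
  h p * ((dx (dx h) p + 2 * dx d.φ p * tan (d.φ p) * dx h p)
    + (dy (dy h) p - 2 * dy d.φ p * cot (d.φ p) * dy h p)
    + (barHZZ d h p + d.φz p ^ 2 * h p))
  - (dx h p ^ 2 / cos (d.φ p) ^ 2 + dy h p ^ 2 / sin (d.φ p) ^ 2 + k p ^ 2)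

/-- The four equations on `V` for `h = e^{-P}` and `k = (e^{-P})_z`. -/
structure IsInitialSolution (V : Set (ℝ × ℝ)) (d : InitialData) (h k : ℝ × ℝ → ℝ) : Prop where
  eq_xy : ∀ p ∈ V, dy (dx h) p - dy h p * dx d.φ p * cot (d.φ p)
    + dx h p * dy d.φ p * tan (d.φ p) = 0
  eq_xz : ∀ p ∈ V, dx k p + dx h p * d.φz p * tan (d.φ p)
    - h p * dx d.φz p * cot (d.φ p) = 0
  eq_yz : ∀ p ∈ V, dy k p - dy h p * d.φz p * cot (d.φ p)
    + h p * dy d.φz p * tan (d.φ p) = 0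
  eq_zeta : ∀ p ∈ V, barKappa3 d h k p ^ 2 = barZeta d h k p

/-! ### Guichard nets -/

/-- The 3-metric `cos² φ dx² + sin² φ dy² + dz²`, as a bilinear form at the point `q`. -/
def metric3 (φ : (ℝ × ℝ) × ℝ → ℝ) (q v w : (ℝ × ℝ) × ℝ) : ℝ :=
  cos (φ q) ^ 2 * (v.1.1 * w.1.1) + sin (φ q) ^ 2 * (v.1.2 * w.1.2) + v.2 * w.2

/-- The metric `metric3 φ` is conformally flat on `U`: near each point it is, up to a positive
factor, the pull-back of the Euclidean metric of three-space under a smooth map. -/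
def IsConformallyFlat (U : Set ((ℝ × ℝ) × ℝ)) (φ : (ℝ × ℝ) × ℝ → ℝ) : Prop :=
  ∀ q ∈ U, ∃ W : Set ((ℝ × ℝ) × ℝ), IsOpen W ∧ q ∈ W ∧ W ⊆ U ∧
    ∃ (u : (ℝ × ℝ) × ℝ → ℝ) (F : (ℝ × ℝ) × ℝ → EuclideanSpace ℝ (Fin 3)),
      ContDiffOn ℝ ∞ u W ∧ ContDiffOn ℝ ∞ F W ∧
      ∀ r ∈ W, ∀ v w : (ℝ × ℝ) × ℝ,
        inner ℝ (fderiv ℝ F r v) (fderiv ℝ F r w) = exp (2 * u r) * metric3 φ r v w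

/-- The metric `metric3 φ` on `U` belongs to `Met`: it is an analytic conformally flat Riemannian
metric, and `φ_z φ_xz φ_yz` has no zero. -/
structure MemMet (U : Set ((ℝ × ℝ) × ℝ)) (φ : (ℝ × ℝ) × ℝ → ℝ) : Prop where
  analytic : AnalyticOnNhd ℝ φ U
  sin_ne : ∀ q ∈ U, sin (φ q) ≠ 0
  cos_ne : ∀ q ∈ U, cos (φ q) ≠ 0
  conformallyFlat : IsConformallyFlat U φ
  ne_zero : ∀ q ∈ U, Dz φ q * Dx (Dz φ) q * Dy (Dz φ) q ≠ 0

/-- `metric3 φ` on `V × I` is the Guichard net issuing from the initial data `d`: it belongs to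
`Met`, and `φ` together with a function `ψ` solves the evolution equations with initial data `d`. -/
def IsNetIssuingFrom (V : Set (ℝ × ℝ)) (I : Set ℝ) (d : InitialData)
    (φ : (ℝ × ℝ) × ℝ → ℝ) : Prop :=
  MemMet (V ×ˢ I) φ ∧ ∃ ψ : (ℝ × ℝ) × ℝ → ℝ, AnalyticOnNhd ℝ ψ (V ×ˢ I) ∧
    (∀ q ∈ V ×ˢ I,
      Dz (Dz ψ) q = (Dx (Dx φ) q - Dy (Dy φ) q) * sin (2 * φ q)
        - (Dx (Dx ψ) q - Dy (Dy ψ) q) * cos (2 * φ q)) ∧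
    (∀ q ∈ V ×ˢ I,
      Dz (Dz φ) q = (Dx (Dx φ) q - Dy (Dy φ) q) * cos (2 * φ q)
        + (Dx (Dx ψ) q - Dy (Dy ψ) q) * sin (2 * φ q)) ∧
    ∀ p ∈ V, φ (p, 0) = d.φ p ∧ Dz φ (p, 0) = d.φz p ∧ ψ (p, 0) = d.ψ p ∧ Dz ψ (p, 0) = d.ψz p

/-! ### The set `Ξ_g` -/

/-- `ψ_zz = (φ_xx - φ_yy - φ_zz cos 2φ) / sin 2φ`. -/
def psiZZ (φ : (ℝ × ℝ) × ℝ → ℝ) (q : (ℝ × ℝ) × ℝ) : ℝ :=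
  (Dx (Dx φ) q - Dy (Dy φ) q - Dz (Dz φ) q * cos (2 * φ q)) / sin (2 * φ q)

/-- The function `κ₃` made from `h = e^{-P}`. -/
def kappa3 (φ h : (ℝ × ℝ) × ℝ → ℝ) (q : (ℝ × ℝ) × ℝ) : ℝ :=
  (tan (φ q) * Dx (Dx h) q - Dx φ q * (cos (2 * φ q) / cos (φ q) ^ 2) * Dx h q)
  - (cot (φ q) * Dy (Dy h) q - Dy φ q * (cos (2 * φ q) / sin (φ q) ^ 2) * Dy h q)
  + (h q * Dz (Dz φ) q - Dz h q * Dz φ q)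

/-- The function `ζ` made from `h = e^{-P}`. -/
def zeta (φ h : (ℝ × ℝ) × ℝ → ℝ) (q : (ℝ × ℝ) × ℝ) : ℝ :=
  h q * ((Dx (Dx h) q + 2 * Dx φ q * tan (φ q) * Dx h q)
    + (Dy (Dy h) q - 2 * Dy φ q * cot (φ q) * Dy h q)
    + (Dz (Dz h) q + Dz φ q ^ 2 * h q))
  - (Dx h q ^ 2 / cos (φ q) ^ 2 + Dy h q ^ 2 / sin (φ q) ^ 2 + Dz h q ^ 2)

/-- `h = e^{-P}` is a member of `Ξ_g`, where `g` is the metric `metric3 φ` on `U`: a positive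
function with `I^{x,y} = I^{x,z} = I^{y,z} = 0`, with the linear evolution equation, and
with `J = ζ - κ₃² = 0`. -/
structure MemXi (U : Set ((ℝ × ℝ) × ℝ)) (φ h : (ℝ × ℝ) × ℝ → ℝ) : Prop where
  smooth : ContDiffOn ℝ ∞ h U
  pos : ∀ q ∈ U, 0 < h q
  eq_xy : ∀ q ∈ U, Dy (Dx h) q - Dy h q * Dx φ q * cot (φ q) + Dx h q * Dy φ q * tan (φ q) = 0
  eq_xz : ∀ q ∈ U, Dx (Dz h) q + Dx h q * Dz φ q * tan (φ q) - h q * Dx (Dz φ) q * cot (φ q) = 0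
  eq_yz : ∀ q ∈ U, Dy (Dz h) q - Dy h q * Dz φ q * cot (φ q) + h q * Dy (Dz φ) q * tan (φ q) = 0
  evolution : ∀ q ∈ U, Dz (Dz h) q =
    (Dx (Dx h) q + 2 * Dx φ q * tan (φ q) * Dx h q)
    + (Dy (Dy h) q - 2 * Dy φ q * cot (φ q) * Dy h q)
    + (1 - 2 * psiZZ φ q) * h q
  J_zero : ∀ q ∈ U, zeta φ h q - kappa3 φ h q ^ 2 = 0

end GuichardNet

end

/-! Write `T = tan φ`, `C = cot φ`, `w = φ_z`, `Z = φ_zz`, `W = ψ_zz`, `k = h_z`. All functions are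
analytic and `V` is connected, so `κ̄₁κ̄₂ ≡ 0` forces one factor to vanish identically. Exchanging
the coordinates, `T` with `C`, and the signs of `φ`, `w`, `Z` maps `κ̄₂` to `-κ̄₁`; hence only `κ̄₁
≡ 0` needs a computation.

If `κ̄₁ = 0`, then `κ̄₃ = -hT` and the last equation of the system reads `ζ̄ = h²T²`. The
`x`-derivatives of these two identities contain the third derivatives of `h` only through `h_xxx`
and `h_xyy`. The `y`-derivative of the equation for `h_xy` gives `h_xyy`, and a suitable combination
cancels everything except a nonzero multiple of `φ_x` (`dirD_φ_eq_zero`). So `φ` depends on `y`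
alone. The compatibility conditions then give `w_y = w φ_y C` (`dirD_w_eq`), that is, `φ_z / sin φ`
depends on `x` alone; reading off `ρ` and `σ` makes the metric special.

For the second claim, a member of `Ξ_g` satisfies the `(y, z)`-equation for all `z` in the interval,
so also its `z`-derivative holds on `z = 0`. This is a further condition on the initial data. With
the special potential it says that `h / cos φ` is independent of `y` (`dirD_h_eq`). Then `κ̄₁ = 0`
and `ζ̄ = h²T²` combine to `(1 + T²)(h² + h_x²) + (k - wCh)² = 0`, which is impossible for `h > 0`
(`false_of_dirD_h_eq`). -/

noncomputable section

namespace GuichardNet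

/-! ### Directional derivatives -/

section Directional

variable {X : Type*} [NormedAddCommGroup X] [NormedSpace ℝ X]

/-- The derivative of `f` in the direction `v`. -/
def dirD (v : X) (f : X → ℝ) : X → ℝ := fun p => fderiv ℝ f p v

theorem dirD_add (v : X) {f g : X → ℝ} {p : X} (hf : DifferentiableAt ℝ f p)
    (hg : DifferentiableAt ℝ g p) :
    dirD v (fun q => f q + g q) p = dirD v f p + dirD v g p := by
  simp [dirD, fderiv_fun_add hf hg]

theorem dirD_sub (v : X) {f g : X → ℝ} {p : X} (hf : DifferentiableAt ℝ f p)
    (hg : DifferentiableAt ℝ g p) :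
    dirD v (fun q => f q - g q) p = dirD v f p - dirD v g p := by
  simp [dirD, fderiv_fun_sub hf hg]

theorem dirD_mul (v : X) {f g : X → ℝ} {p : X} (hf : DifferentiableAt ℝ f p)
    (hg : DifferentiableAt ℝ g p) :
    dirD v (fun q => f q * g q) p = f p * dirD v g p + g p * dirD v f p := by
  simp [dirD, fderiv_fun_mul hf hg]

theorem dirD_sq (v : X) {f : X → ℝ} {p : X} (hf : DifferentiableAt ℝ f p) :
    dirD v (fun q => f q ^ 2) p = 2 * f p * dirD v f p := by
  simp only [pow_two, dirD_mul v hf hf]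
  ring

theorem dirD_neg (v : X) (f : X → ℝ) (p : X) :
    dirD v (fun q => -f q) p = -dirD v f p := by
  simp [dirD, fderiv_fun_neg]

theorem dirD_neg_fun (v : X) (f : X → ℝ) :
    dirD v (fun q => -f q) = fun q => -dirD v f q :=
  funext fun p => dirD_neg v f p

theorem dirD_const (v : X) (c : ℝ) (p : X) : dirD v (fun _ => c) p = 0 := by
  simp [dirD]

theorem dirD_congr {U : Set X} (hU : IsOpen U) {f g : X → ℝ} (h : ∀ q ∈ U, f q = g q) (v : X)
    {p : X} (hp : p ∈ U) : dirD v f p = dirD v g p := by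
  have : f =ᶠ[nhds p] g := Filter.eventuallyEq_of_mem (hU.mem_nhds hp) h
  simp [dirD, this.fderiv_eq]

theorem analyticOnNhd_dirD {U : Set X} {f : X → ℝ} (hf : AnalyticOnNhd ℝ f U) (v : X) :
    AnalyticOnNhd ℝ (dirD v f) U := fun p hp =>
  ((ContinuousLinearMap.apply ℝ ℝ v).analyticAt _).comp (hf.fderiv p hp)

theorem contDiffOn_dirD {U : Set X} (hU : IsOpen U) {f : X → ℝ} (hf : ContDiffOn ℝ ∞ f U) (v : X) :
    ContDiffOn ℝ ∞ (dirD v f) U :=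
  ((ContinuousLinearMap.apply ℝ ℝ v).contDiff (n := ∞)).comp_contDiffOn
    (hf.fderiv_of_isOpen hU (by norm_cast))

theorem dirD_comm {f : X → ℝ} {p : X} (hf : ContDiffAt ℝ 2 f p) (u v : X) :
    dirD u (dirD v f) p = dirD v (dirD u f) p := by
  have hd : DifferentiableAt ℝ (fderiv ℝ f) p :=
    (hf.fderiv_right (m := 1) (by norm_num)).differentiableAt (by norm_num)
  have key : ∀ u v : X, dirD u (dirD v f) p = fderiv ℝ (fderiv ℝ f) p u v := by
    intro u v
    have := ((ContinuousLinearMap.apply ℝ ℝ v).hasFDerivAt.comp p hd.hasFDerivAt).fderiv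
    change fderiv ℝ ((ContinuousLinearMap.apply ℝ ℝ v) ∘ fderiv ℝ f) p u = _
    rw [this]; rfl
  rw [key, key]
  exact hf.isSymmSndFDerivAt (by simp) u v

theorem dirD_comm_of_analytic {f : X → ℝ} {p : X} (hf : AnalyticAt ℝ f p) (u v : X) :
    dirD u (dirD v f) p = dirD v (dirD u f) p :=
  dirD_comm hf.contDiffAt u v

end Directional

/-! ### The overdetermined system in `tan φ` and `cot φ`: reduction to one variable and
contradiction -/

section Core

variable {X : Type*} [NormedAddCommGroup X] [NormedSpace ℝ X]

/-- Data determined by a 2-metric in terms of `T = tan φ` and `C = cot φ`, with `w = φ_z`,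
`Z = φ_zz` and `W = ψ_zz`; the two directions `a` and `b` are those of the coordinates. -/
structure DeterminedData (U : Set X) (a b : X) (φ w T C Z W : X → ℝ) : Prop where
  isOpen : IsOpen U
  an_φ : AnalyticOnNhd ℝ φ U
  an_w : AnalyticOnNhd ℝ w U
  an_T : AnalyticOnNhd ℝ T U
  an_C : AnalyticOnNhd ℝ C U
  an_Z : AnalyticOnNhd ℝ Z U
  an_W : AnalyticOnNhd ℝ W U
  TC : ∀ p ∈ U, T p * C p = 1
  DT : ∀ v, ∀ p ∈ U, dirD v T p = (1 + T p ^ 2) * dirD v φ p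
  DC : ∀ v, ∀ p ∈ U, dirD v C p = -((1 + C p ^ 2) * dirD v φ p)
  wa_ne : ∀ p ∈ U, dirD a w p ≠ 0
  wb_ne : ∀ p ∈ U, dirD b w p ≠ 0
  -- Equality of the mixed derivatives of `ψ_z`, whose first derivatives are `-w_a C` and `w_b T`.
  wab : ∀ p ∈ U, dirD b (dirD a w) p * (C p + T p) =
    dirD a w p * (1 + C p ^ 2) * dirD b φ p - dirD b w p * (1 + T p ^ 2) * dirD a φ p
  -- The evolution equations inverted: `Lφ = Z cos 2φ + W sin 2φ`. In this form `ψ` has disappeared.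
  lap : ∀ p ∈ U, (1 + T p ^ 2) * (dirD a (dirD a φ) p - dirD b (dirD b φ) p) =
    (1 - T p ^ 2) * Z p + 2 * T p * W p
  compat_a : ∀ p ∈ U, dirD a W p + C p * dirD a Z p = (1 + C p ^ 2) * (w p * dirD a w p)
  compat_b : ∀ p ∈ U, dirD b W p - T p * dirD b Z p = (1 + T p ^ 2) * (w p * dirD b w p)

/-- The function `κ̄₃` in terms of `T = tan φ` and `C = cot φ`. -/
def dirKappa3 (a b : X) (φ w T C Z h k : X → ℝ) (p : X) : ℝ :=
  (T p * dirD a (dirD a h) p - dirD a φ p * (1 - T p ^ 2) * dirD a h p)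
  - (C p * dirD b (dirD b h) p - dirD b φ p * (C p ^ 2 - 1) * dirD b h p)
  + (h p * Z p - k p * w p)

/-- The expression `h_zz` in terms of `T = tan φ` and `C = cot φ`. -/
def dirHZZ (a b : X) (φ T C W h : X → ℝ) (p : X) : ℝ :=
  (dirD a (dirD a h) p + 2 * dirD a φ p * T p * dirD a h p)
  + (dirD b (dirD b h) p - 2 * dirD b φ p * C p * dirD b h p) + (1 - 2 * W p) * h p

/-- The system for `(h, k) = (e^{-P}, (e^{-P})_z)` in terms of `T = tan φ` and `C = cot φ`. -/
structure SolvesInitialSystem (U : Set X) (a b : X) (φ w T C Z W h k : X → ℝ) : Prop where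
  an_h : AnalyticOnNhd ℝ h U
  an_k : AnalyticOnNhd ℝ k U
  pos : ∀ p ∈ U, 0 < h p
  hab : ∀ p ∈ U, dirD b (dirD a h) p =
    dirD b h p * dirD a φ p * C p - dirD a h p * dirD b φ p * T p
  ka : ∀ p ∈ U, dirD a k p = -(dirD a h p * w p * T p) + h p * dirD a w p * C p
  kb : ∀ p ∈ U, dirD b k p = dirD b h p * w p * C p - h p * dirD b w p * T p
  zeta : ∀ p ∈ U, dirKappa3 a b φ w T C Z h k p ^ 2 =
    h p * ((dirD a (dirD a h) p + 2 * dirD a φ p * T p * dirD a h p)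
      + (dirD b (dirD b h) p - 2 * dirD b φ p * C p * dirD b h p)
      + (dirHZZ a b φ T C W h p + w p ^ 2 * h p))
    - ((1 + T p ^ 2) * dirD a h p ^ 2 + (1 + C p ^ 2) * dirD b h p ^ 2 + k p ^ 2)

variable {U : Set X} {a b : X} {φ w T C Z W h k : X → ℝ}

/-- The geometric symmetry replaces `φ` by `π / 2 - φ`. Here `φ` enters only through its
derivatives, `T` and `C`, so `-φ` serves equally well once `T` and `C` are exchanged. -/
theorem DeterminedData.swap (D : DeterminedData U a b φ w T C Z W) :
    DeterminedData U b a (fun p => -φ p) (fun p => -w p) C T (fun p => -Z p) W where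
  isOpen := D.isOpen
  an_φ := D.an_φ.neg
  an_w := D.an_w.neg
  an_T := D.an_C
  an_C := D.an_T
  an_Z := D.an_Z.neg
  an_W := D.an_W
  TC p hp := by rw [mul_comm]; exact D.TC p hp
  DT v p hp := by rw [D.DC v p hp, dirD_neg]; ring
  DC v p hp := by rw [D.DT v p hp, dirD_neg]; ring
  wa_ne p hp := by rw [dirD_neg]; exact neg_ne_zero.2 (D.wb_ne p hp)
  wb_ne p hp := by rw [dirD_neg]; exact neg_ne_zero.2 (D.wa_ne p hp)
  wab p hp := by
    simp only [dirD_neg_fun]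
    rw [dirD_comm_of_analytic (D.an_w p hp)]
    linear_combination (-1) * D.wab p hp
  lap p hp := by
    simp only [dirD_neg_fun]
    linear_combination C p ^ 2 * D.lap p hp
      - ((dirD a (dirD a φ) p - dirD b (dirD b φ) p) * (T p * C p + 1) + Z p * (T p * C p + 1)
        - 2 * W p * C p) * D.TC p hp
  compat_a p hp := by
    simp only [dirD_neg_fun]
    linear_combination D.compat_b p hp
  compat_b p hp := by
    simp only [dirD_neg_fun]
    linear_combination D.compat_a p hp

theorem dirKappa3_swap (a b : X) (φ w T C Z h k : X → ℝ) (p : X) :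
    dirKappa3 b a (fun p => -φ p) (fun p => -w p) C T (fun p => -Z p) h k p =
      -dirKappa3 a b φ w T C Z h k p := by
  simp only [dirKappa3, dirD_neg_fun]; ring

theorem dirHZZ_swap (a b : X) (φ T C W h : X → ℝ) (p : X) :
    dirHZZ b a (fun p => -φ p) C T W h p = dirHZZ a b φ T C W h p := by
  simp only [dirHZZ, dirD_neg_fun]; ring

theorem SolvesInitialSystem.swap (S : SolvesInitialSystem U a b φ w T C Z W h k) :
    SolvesInitialSystem U b a (fun p => -φ p) (fun p => -w p) C T (fun p => -Z p) W h k where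
  an_h := S.an_h
  an_k := S.an_k
  pos := S.pos
  hab p hp := by
    simp only [dirD_neg_fun]
    rw [dirD_comm_of_analytic (S.an_h p hp)]
    linear_combination S.hab p hp
  ka p hp := by
    simp only [dirD_neg_fun]
    linear_combination S.kb p hp
  kb p hp := by
    simp only [dirD_neg_fun]
    linear_combination S.ka p hp
  zeta p hp := by
    rw [dirKappa3_swap, dirHZZ_swap]
    simp only [dirD_neg_fun]
    linear_combination S.zeta p hp

theorem DeterminedData.mono (D : DeterminedData U a b φ w T C Z W) {U' : Set X} (ho : IsOpen U')
    (hU : U' ⊆ U) : DeterminedData U' a b φ w T C Z W where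
  isOpen := ho
  an_φ := D.an_φ.mono hU
  an_w := D.an_w.mono hU
  an_T := D.an_T.mono hU
  an_C := D.an_C.mono hU
  an_Z := D.an_Z.mono hU
  an_W := D.an_W.mono hU
  TC p hp := D.TC p (hU hp)
  DT v p hp := D.DT v p (hU hp)
  DC v p hp := D.DC v p (hU hp)
  wa_ne p hp := D.wa_ne p (hU hp)
  wb_ne p hp := D.wb_ne p (hU hp)
  wab p hp := D.wab p (hU hp)
  lap p hp := D.lap p (hU hp)
  compat_a p hp := D.compat_a p (hU hp)
  compat_b p hp := D.compat_b p (hU hp)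

theorem SolvesInitialSystem.mono (S : SolvesInitialSystem U a b φ w T C Z W h k) {U' : Set X}
    (hU : U' ⊆ U) : SolvesInitialSystem U' a b φ w T C Z W h k where
  an_h := S.an_h.mono hU
  an_k := S.an_k.mono hU
  pos p hp := S.pos p (hU hp)
  hab p hp := S.hab p (hU hp)
  ka p hp := S.ka p (hU hp)
  kb p hp := S.kb p (hU hp)
  zeta p hp := S.zeta p (hU hp)

/-- Differential elimination: the `a`-derivatives of `κ̄₁ = 0` and of `ζ̄ = h²T²`, with the
`b`-derivative of the equation for `h_ab`, suffice to remove all third derivatives of `h`. -/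
theorem dirD_φ_eq_zero (D : DeterminedData U a b φ w T C Z W)
    (S : SolvesInitialSystem U a b φ w T C Z W h k)
    (hκ : ∀ p ∈ U, h p * T p + dirKappa3 a b φ w T C Z h k p = 0) {p : X} (hp : p ∈ U) :
    dirD a φ p = 0 := by
  have dT := (D.an_T p hp).differentiableAt
  have dC := (D.an_C p hp).differentiableAt
  have dw := (D.an_w p hp).differentiableAt
  have dZ := (D.an_Z p hp).differentiableAt
  have dW := (D.an_W p hp).differentiableAt
  have dh := (S.an_h p hp).differentiableAt
  have dk := (S.an_k p hp).differentiableAt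
  have dφa := (analyticOnNhd_dirD D.an_φ a p hp).differentiableAt
  have dφb := (analyticOnNhd_dirD D.an_φ b p hp).differentiableAt
  have dha := (analyticOnNhd_dirD S.an_h a p hp).differentiableAt
  have dhb := (analyticOnNhd_dirD S.an_h b p hp).differentiableAt
  have dhaa := (analyticOnNhd_dirD (analyticOnNhd_dirD S.an_h a) a p hp).differentiableAt
  have dhbb := (analyticOnNhd_dirD (analyticOnNhd_dirD S.an_h b) b p hp).differentiableAt
  have e1 := dirD_congr D.isOpen hκ a hp
  -- The equation `κ̄₃² = ζ̄` with `κ̄₃ = -hT` inserted, differentiated along `a`.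
  have e2 := dirD_congr D.isOpen (f := fun p =>
    h p * ((dirD a (dirD a h) p + 2 * dirD a φ p * T p * dirD a h p)
      + (dirD b (dirD b h) p - 2 * dirD b φ p * C p * dirD b h p)
      + (dirHZZ a b φ T C W h p + w p ^ 2 * h p))
    - ((1 + T p ^ 2) * dirD a h p ^ 2 + (1 + C p ^ 2) * dirD b h p ^ 2 + k p ^ 2))
    (g := fun p => (h p * T p) ^ 2) (fun q hq => by
      rw [← S.zeta q hq, eq_neg_of_add_eq_zero_right (hκ q hq)]; ring) a hp
  have e3 := dirD_congr D.isOpen S.hab b hp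
  have c3 : dirD b (dirD b (dirD a h)) p = dirD a (dirD b (dirD b h)) p := by
    rw [dirD_comm_of_analytic (analyticOnNhd_dirD S.an_h b p hp)]
    exact dirD_congr D.isOpen (fun q hq => dirD_comm_of_analytic (S.an_h q hq) b a) b hp
  have c2 : dirD a (dirD b h) p = dirD b (dirD a h) p := dirD_comm_of_analytic (S.an_h p hp) a b
  have cφ : dirD a (dirD b φ) p = dirD b (dirD a φ) p := dirD_comm_of_analytic (D.an_φ p hp) a b
  unfold dirKappa3 at e1
  unfold dirHZZ at e2
  rw [c3] at e3
  simp (disch := fun_prop) only [dirD_add, dirD_sub, dirD_mul, dirD_sq, dirD_const,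
    D.DT _ p hp, D.DC _ p hp, c2, cφ, S.hab p hp, S.ka p hp] at e1 e2 e3
  have hc := D.compat_a p hp
  have hl := D.lap p hp
  have hTC := D.TC p hp
  have hh := S.pos p hp
  have hk := hκ p hp
  unfold dirKappa3 at hk
  have hT : T p ≠ 0 := left_ne_zero_of_mul_eq_one hTC
  have hC : C p = (T p)⁻¹ := eq_inv_of_mul_eq_one_right hTC
  rw [hC] at e1 e2 e3 hc hk
  -- The factor `2hC` of `e1` cancels `h_aaa`, the factor `2h(1 + C²)` of `e3` then cancels `h_abb`,
  -- and `-2h²` times `hc` cancels `W_a` and `Z_a`. The undifferentiated identities `hk` and `hl`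
  -- clear the remaining second-order terms.
  have key : 2 * (h p) ^ 2 * (T p + (T p)⁻¹) * (1 + T p ^ 2) * dirD a φ p = 0 := by
    linear_combination (norm := (field_simp; ring)) (-1) * e2 + 2 * h p * (T p)⁻¹ * e1
      + 2 * h p * (1 + (T p)⁻¹ ^ 2) * e3 - 2 * h p ^ 2 * hc
      - 2 * T p * dirD a h p * hk + 2 * h p * dirD a h p * (T p)⁻¹ * hl
  have h1 : T p + (T p)⁻¹ = (1 + T p ^ 2) / T p := by field_simp; ring
  have h2 : (1 + T p ^ 2) ≠ 0 := by positivity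
  rw [h1] at key
  simpa [hT, h2, hh.ne'] using key

/-- When `φ_a = 0`, the `a`-derivative of `lap` is a second linear equation for `Z_a` and `W_a`
besides `compat_a`; solving gives `Z_a = 2C w w_a` and `W_a = (1 - C²) w w_a`. Integrability against
`compat_b` leaves the claim multiplied by `w_a`, which has no zero. -/
theorem dirD_w_eq (D : DeterminedData U a b φ w T C Z W)
    (hφ : ∀ p ∈ U, dirD a φ p = 0) {p : X} (hp : p ∈ U) :
    dirD b w p = w p * dirD b φ p * C p := by
  have hTa : ∀ q ∈ U, dirD a T q = 0 := fun q hq => by rw [D.DT a q hq, hφ q hq, mul_zero]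
  have hφz : ∀ v, ∀ q ∈ U, dirD v (dirD a φ) q = 0 := fun v q hq => by
    rw [dirD_congr D.isOpen hφ v hq, dirD_const]
  have hφab : ∀ q ∈ U, dirD a (dirD b φ) q = 0 := fun q hq => by
    rw [dirD_comm_of_analytic (D.an_φ q hq), hφz b q hq]
  have hφabb : ∀ q ∈ U, dirD a (dirD b (dirD b φ)) q = 0 := fun q hq => by
    rw [dirD_comm_of_analytic (analyticOnNhd_dirD D.an_φ b q hq), dirD_congr D.isOpen hφab b hq,
      dirD_const]
  have hlap : ∀ q ∈ U, (1 - T q ^ 2) * dirD a Z q + 2 * T q * dirD a W q = 0 := fun q hq => by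
    have dT := (D.an_T q hq).differentiableAt
    have dZ := (D.an_Z q hq).differentiableAt
    have dW := (D.an_W q hq).differentiableAt
    have dφa := (analyticOnNhd_dirD (analyticOnNhd_dirD D.an_φ a) a q hq).differentiableAt
    have dφb := (analyticOnNhd_dirD (analyticOnNhd_dirD D.an_φ b) b q hq).differentiableAt
    have e := dirD_congr D.isOpen D.lap a hq
    have hφaa : dirD a (dirD a (dirD a φ)) q = 0 := by
      rw [dirD_congr D.isOpen (hφz a) a hq, dirD_const]
    simp (disch := fun_prop) only [dirD_add, dirD_sub, dirD_mul, dirD_sq, dirD_const, hTa q hq,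
      hφabb q hq, hφaa] at e
    linear_combination -e
  have hZW : ∀ q ∈ U, dirD a Z q = 2 * (C q * (w q * dirD a w q)) ∧
      dirD a W q = (1 - C q ^ 2) * (w q * dirD a w q) := fun q hq => by
    have hT : T q ≠ 0 := left_ne_zero_of_mul_eq_one (D.TC q hq)
    have hC : C q = (T q)⁻¹ := eq_inv_of_mul_eq_one_right (D.TC q hq)
    have e1 := hlap q hq
    have e2 := D.compat_a q hq
    rw [hC] at e2 ⊢
    have h2 : (1 + T q ^ 2) ≠ 0 := by positivity
    have hZ : dirD a Z q = 2 * ((T q)⁻¹ * (w q * dirD a w q)) := by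
      apply mul_left_cancel₀ h2
      linear_combination (norm := (field_simp; ring)) 2 * T q * e2 - e1
    refine ⟨hZ, ?_⟩
    rw [hZ] at e2
    linear_combination (norm := (field_simp; ring)) e2
  have dT := (D.an_T p hp).differentiableAt
  have dC := (D.an_C p hp).differentiableAt
  have dw := (D.an_w p hp).differentiableAt
  have dwa := (analyticOnNhd_dirD D.an_w a p hp).differentiableAt
  have dwb := (analyticOnNhd_dirD D.an_w b p hp).differentiableAt
  have dZb := (analyticOnNhd_dirD D.an_Z b p hp).differentiableAt
  have dWb := (analyticOnNhd_dirD D.an_W b p hp).differentiableAt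
  have e1 := dirD_congr D.isOpen (fun q hq => (hZW q hq).1) b hp
  have e2 := dirD_congr D.isOpen (fun q hq => (hZW q hq).2) b hp
  have e3 := dirD_congr D.isOpen D.compat_b a hp
  have e4 := D.wab p hp
  rw [dirD_comm_of_analytic (D.an_Z p hp)] at e1
  rw [dirD_comm_of_analytic (D.an_W p hp)] at e2
  simp (disch := fun_prop) only [dirD_add, dirD_sub, dirD_mul, dirD_sq, dirD_const, hTa p hp,
    D.DC b p hp, dirD_comm_of_analytic (D.an_w p hp) a b] at e1 e2 e3
  rw [hφ p hp] at e4
  have hT : T p ≠ 0 := left_ne_zero_of_mul_eq_one (D.TC p hp)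
  have hC : C p = (T p)⁻¹ := eq_inv_of_mul_eq_one_right (D.TC p hp)
  rw [hC] at e1 e2 e4 ⊢
  have h2 : (1 + T p ^ 2) ≠ 0 := by positivity
  -- `C + T = C(1 + T²)`, so for `φ_a = 0` the relation `wab` can be solved for the mixed
  -- derivative.
  have hwab : dirD b (dirD a w) p = dirD a w p * dirD b φ p * (T p)⁻¹ := by
    apply mul_left_cancel₀ h2
    linear_combination (norm := (field_simp; ring)) T p * e4
  rw [hwab] at e1 e2 e3
  have h3 : (1 + T p ^ 2) ^ 2 * dirD a w p ≠ 0 :=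
    mul_ne_zero (pow_ne_zero 2 h2) (D.wa_ne p hp)
  apply mul_left_cancel₀ h3
  -- `W_ab - T Z_ab` computed twice: from the formulas for `W_a` and `Z_a`, and from the
  -- `a`-derivative of `compat_b`.
  linear_combination (norm := (field_simp; ring)) T p ^ 2 * (e2 - T p * e1 - e3)

/-- The `z`-derivative of the equation `I^{b,z} = 0` on `z = 0`, for `φ` independent of the first
coordinate and the special potential, makes `h / cos φ` independent of the second one. -/
theorem dirD_h_eq (D : DeterminedData U a b φ w T C Z W)
    (S : SolvesInitialSystem U a b φ w T C Z W h k)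
    (hκ : ∀ p ∈ U, h p * T p + dirKappa3 a b φ w T C Z h k p = 0)
    (hφ : ∀ p ∈ U, dirD a φ p = 0)
    (hZ : ∀ p ∈ U, Z p = -dirD b (dirD b φ) p + C p * w p ^ 2 - T p * dirD b φ p ^ 2)
    (hW : ∀ p ∈ U, W p = -(dirD b (dirD b φ) p * T p)
      - (1 / 2) * (w p ^ 2 * (C p ^ 2 - 1) - dirD b φ p ^ 2 * (1 - T p ^ 2)))
    {p : X} (hp : p ∈ U)
    (hI : dirD b (dirHZZ a b φ T C W h) p
      - (dirD b k p * w p * C p + dirD b h p * Z p * C p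
        - dirD b h p * w p * ((1 + C p ^ 2) * w p))
      + (k p * dirD b w p * T p + h p * dirD b Z p * T p
        + h p * dirD b w p * ((1 + T p ^ 2) * w p)) = 0) :
    dirD b h p = -(h p * dirD b φ p * T p) := by
  have dT := (D.an_T p hp).differentiableAt
  have dC := (D.an_C p hp).differentiableAt
  have dw := (D.an_w p hp).differentiableAt
  have dZ := (D.an_Z p hp).differentiableAt
  have dW := (D.an_W p hp).differentiableAt
  have dh := (S.an_h p hp).differentiableAt
  have dk := (S.an_k p hp).differentiableAt
  have dφa := (analyticOnNhd_dirD D.an_φ a p hp).differentiableAt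
  have dφb := (analyticOnNhd_dirD D.an_φ b p hp).differentiableAt
  have dφbb := (analyticOnNhd_dirD (analyticOnNhd_dirD D.an_φ b) b p hp).differentiableAt
  have dha := (analyticOnNhd_dirD S.an_h a p hp).differentiableAt
  have dhb := (analyticOnNhd_dirD S.an_h b p hp).differentiableAt
  have dhaa := (analyticOnNhd_dirD (analyticOnNhd_dirD S.an_h a) a p hp).differentiableAt
  have dhbb := (analyticOnNhd_dirD (analyticOnNhd_dirD S.an_h b) b p hp).differentiableAt
  have hφz : ∀ v, ∀ q ∈ U, dirD v (dirD a φ) q = 0 := fun v q hq => by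
    rw [dirD_congr D.isOpen hφ v hq, dirD_const]
  have hφab : dirD a (dirD b φ) p = 0 := by
    rw [dirD_comm_of_analytic (D.an_φ p hp), hφz b p hp]
  have c3 : dirD b (dirD a (dirD a h)) p = dirD a (dirD b (dirD a h)) p :=
    dirD_comm_of_analytic (analyticOnNhd_dirD S.an_h a p hp) b a
  have e1 := dirD_congr D.isOpen hκ b hp
  -- Since `φ_a = 0`, this expresses `h_aab` as `-h_aa φ_b T` and lowers its order.
  have e3 := dirD_congr D.isOpen S.hab a hp
  have eZ := dirD_congr D.isOpen hZ b hp
  have eW := dirD_congr D.isOpen hW b hp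
  rw [← c3] at e3
  unfold dirKappa3 at e1
  unfold dirHZZ at hI
  simp (disch := fun_prop) only [dirD_add, dirD_sub, dirD_mul, dirD_sq, dirD_neg, dirD_const,
    D.DT _ p hp, D.DC _ p hp, hφ p hp, hφz _ p hp, hφab, S.kb p hp, S.hab p hp,
    dirD_w_eq D hφ hp] at e1 e3 eZ eW hI
  rw [e3, eZ] at e1 hI
  rw [eW] at hI
  have hT : T p ≠ 0 := left_ne_zero_of_mul_eq_one (D.TC p hp)
  have hC : C p = (T p)⁻¹ := eq_inv_of_mul_eq_one_right (D.TC p hp)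
  rw [hZ p hp] at e1 hI
  rw [hW p hp] at hI
  rw [hC] at e1 hI
  have h2 : (1 + T p ^ 2) ≠ 0 := by positivity
  apply mul_left_cancel₀ h2
  -- The factor `T` cancels `h_bbb`. What survives comes from the summand `1 · h` of `h_zz`,
  -- contributing `h_b`, and from the term `hT` of `κ̄₁`, contributing `T(hT)_b`.
  linear_combination (norm := (field_simp; ring)) hI + T p * e1

/-- Inserting `h_b = -h φ_b T` and its `b`-derivative leaves `h_aa` as the only second derivative of
`h`. Adding `2hC` times `κ̄₁ = 0` to the `ζ̄`-equation removes it too, and a sum of squares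
containing `h²` remains. -/
theorem false_of_dirD_h_eq (D : DeterminedData U a b φ w T C Z W)
    (S : SolvesInitialSystem U a b φ w T C Z W h k)
    (hκ : ∀ p ∈ U, h p * T p + dirKappa3 a b φ w T C Z h k p = 0)
    (hφ : ∀ p ∈ U, dirD a φ p = 0)
    (hZ : ∀ p ∈ U, Z p = -dirD b (dirD b φ) p + C p * w p ^ 2 - T p * dirD b φ p ^ 2)
    (hW : ∀ p ∈ U, W p = -(dirD b (dirD b φ) p * T p)
      - (1 / 2) * (w p ^ 2 * (C p ^ 2 - 1) - dirD b φ p ^ 2 * (1 - T p ^ 2)))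
    (hb : ∀ p ∈ U, dirD b h p = -(h p * dirD b φ p * T p))
    {p : X} (hp : p ∈ U) : False := by
  have dT := (D.an_T p hp).differentiableAt
  have dh := (S.an_h p hp).differentiableAt
  have dφb := (analyticOnNhd_dirD D.an_φ b p hp).differentiableAt
  have e := dirD_congr D.isOpen hb b hp
  simp (disch := fun_prop) only [dirD_mul, dirD_neg, D.DT _ p hp, hb p hp] at e
  have hk := hκ p hp
  have hz := S.zeta p hp
  rw [eq_neg_of_add_eq_zero_right hk] at hz
  unfold dirKappa3 at hk
  unfold dirHZZ at hz
  rw [e, hφ p hp, hb p hp, hZ p hp] at hk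
  rw [e, hφ p hp, hb p hp, hW p hp] at hz
  have hT : T p ≠ 0 := left_ne_zero_of_mul_eq_one (D.TC p hp)
  have hC : C p = (T p)⁻¹ := eq_inv_of_mul_eq_one_right (D.TC p hp)
  rw [hC] at hk hz
  have hh := S.pos p hp
  have key : (1 + T p ^ 2) * (h p ^ 2 + dirD a h p ^ 2)
      + (k p - w p * (T p)⁻¹ * h p) ^ 2 = 0 := by
    linear_combination (norm := (field_simp; ring)) hz + 2 * h p * (T p)⁻¹ * hk
  have : 0 < (1 + T p ^ 2) * (h p ^ 2 + dirD a h p ^ 2)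
      + (k p - w p * (T p)⁻¹ * h p) ^ 2 := by positivity
  exact this.ne' key

end Core

/-! ### Functions of one variable -/

/-- `f` is, near `p` and near `q`, one and the same analytic function of the second variable. -/
def SameSndGerm (f : ℝ × ℝ → ℝ) (p q : ℝ × ℝ) : Prop :=
  ∃ (J : Set ℝ) (θ : ℝ → ℝ), IsOpen J ∧ J.OrdConnected ∧ p.2 ∈ J ∧ q.2 ∈ J ∧
    AnalyticOnNhd ℝ θ J ∧ (f =ᶠ[nhds p] fun r => θ r.2) ∧ (f =ᶠ[nhds q] fun r => θ r.2)

theorem SameSndGerm.symm {f : ℝ × ℝ → ℝ} {p q : ℝ × ℝ} (h : SameSndGerm f p q) :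
    SameSndGerm f q p := by
  obtain ⟨J, θ, h1, h2, h3, h4, h5, h6, h7⟩ := h
  exact ⟨J, θ, h1, h2, h4, h3, h5, h7, h6⟩

/-- The two one-variable functions agree near the height of the middle point. The overlap of two
intervals is an interval, so the identity theorem makes them agree on all of it and they glue to an
analytic function on the union. -/
theorem SameSndGerm.trans {f : ℝ × ℝ → ℝ} {p q r : ℝ × ℝ} (h : SameSndGerm f p q)
    (h' : SameSndGerm f q r) : SameSndGerm f p r := by
  classical
  obtain ⟨J, θ, oJ, cJ, pJ, qJ, aθ, fp, fq⟩ := h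
  obtain ⟨J', θ', oJ', cJ', qJ', rJ', aθ', fq', fr'⟩ := h'
  have hq : θ =ᶠ[nhds q.2] θ' := by
    have hc : Filter.Tendsto (fun y : ℝ => (q.1, y)) (nhds q.2) (nhds q) :=
      (Continuous.prodMk_right q.1).tendsto q.2
    filter_upwards [hc.eventually fq, hc.eventually fq'] with y h1 h2
    exact h1.symm.trans h2
  have heq : EqOn θ θ' (J ∩ J') :=
    (aθ.mono inter_subset_left).eqOn_of_preconnected_of_eventuallyEq
      (aθ'.mono inter_subset_right) (cJ.inter cJ').isPreconnected ⟨qJ, qJ'⟩ hq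
  have h1 : ∀ y ∈ J, J.piecewise θ θ' y = θ y := fun y hy => piecewise_eq_of_mem _ _ _ hy
  have h2 : ∀ y ∈ J', J.piecewise θ θ' y = θ' y := fun y hy => by
    by_cases hyJ : y ∈ J
    · rw [h1 y hyJ]; exact heq ⟨hyJ, hy⟩
    · exact piecewise_eq_of_notMem _ _ _ hyJ
  have hs : ∀ s : ℝ × ℝ, Filter.Tendsto Prod.snd (nhds s) (nhds s.2) := fun s =>
    continuous_snd.tendsto s
  refine ⟨J ∪ J', J.piecewise θ θ', oJ.union oJ', ?_, Or.inl pJ, Or.inr rJ', ?_, ?_, ?_⟩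
  · exact (cJ.isPreconnected.union q.2 qJ qJ' cJ'.isPreconnected).ordConnected
  · rintro y (hy | hy)
    · exact (aθ y hy).congr (Filter.eventuallyEq_of_mem (oJ.mem_nhds hy) fun z hz => (h1 z hz).symm)
    · exact (aθ' y hy).congr
        (Filter.eventuallyEq_of_mem (oJ'.mem_nhds hy) fun z hz => (h2 z hz).symm)
  · filter_upwards [fp, (hs p).eventually (oJ.mem_nhds pJ)] with s e1 e2
    rw [e1, h1 _ e2]
  · filter_upwards [fr', (hs r).eventually (oJ'.mem_nhds rJ')] with s e1 e2
    rw [e1, h2 _ e2]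

theorem eq_of_dirD_fst_eq_zero {V : Set (ℝ × ℝ)} {f : ℝ × ℝ → ℝ}
    (hf : AnalyticOnNhd ℝ f V) (h0 : ∀ p ∈ V, dirD (1, 0) f p = 0) {p : ℝ × ℝ} {r : ℝ}
    (hr : Metric.ball p r ⊆ V) {q : ℝ × ℝ} (hq : q ∈ Metric.ball p r) : f q = f (p.1, q.2) := by
  rw [← ball_prod_same p.1 p.2 r] at hr hq
  have hd : ∀ t ∈ Metric.ball p.1 r, HasDerivAt (fun t => f (t, q.2)) 0 t := fun t ht => by
    have hV : (t, q.2) ∈ V := hr ⟨ht, hq.2⟩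
    have h1 : HasDerivAt (fun t : ℝ => (t, q.2)) ((1 : ℝ), (0 : ℝ)) t :=
      (hasDerivAt_id t).prodMk (hasDerivAt_const t q.2)
    have := (hf _ hV).differentiableAt.hasFDerivAt.comp_hasDerivAt t h1
    rwa [show fderiv ℝ f (t, q.2) (1, 0) = 0 from h0 _ hV] at this
  have hp : p.1 ∈ Metric.ball p.1 r := Metric.mem_ball_self (Metric.pos_of_mem_ball hq.1)
  exact Metric.isOpen_ball.is_const_of_deriv_eq_zero (convex_ball _ _).isPreconnected
    (fun t ht => (hd t ht).differentiableAt.differentiableWithinAt)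
    (fun t ht => (hd t ht).deriv) hq.1 hp

theorem analyticAt_slice_snd {f : ℝ × ℝ → ℝ} {x y : ℝ} (hf : AnalyticAt ℝ f (x, y)) :
    AnalyticAt ℝ (fun t => f (x, t)) y :=
  hf.comp (g := f) (f := fun t : ℝ => (x, t)) (analyticAt_const.prod analyticAt_id)

/-- Horizontal slices of `V` may be disconnected, so `f_x = 0` gives a function of `y` only locally.
Connectedness of `V` spreads the relation `SameSndGerm` over all pairs of points; as the
continuation takes place over intervals of the `y`-line there is no monodromy, and points of equal
height have equal values. Analyticity is essential: the statement fails for smooth functions. -/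
theorem exists_comp_snd {V : Set (ℝ × ℝ)} (hVo : IsOpen V) (hVc : IsPreconnected V)
    {f : ℝ × ℝ → ℝ} (hf : AnalyticOnNhd ℝ f V) (h0 : ∀ p ∈ V, dirD (1, 0) f p = 0) :
    ∃ θ : ℝ → ℝ, AnalyticOnNhd ℝ θ (Prod.snd '' V) ∧ ∀ p ∈ V, f p = θ p.2 := by
  classical
  have hloc : ∀ p ∈ V, ∃ r > 0, Metric.ball p r ⊆ V := fun p hp =>
    Metric.isOpen_iff.1 hVo p hp
  have hglob : ∀ p ∈ V, ∀ q ∈ V, SameSndGerm f p q := by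
    intro p hp q hq
    refine hVc.induction₂ (SameSndGerm f) (fun p hp => ?_)
      (fun x y z _ _ _ => SameSndGerm.trans) (fun x y _ _ => SameSndGerm.symm) hp hq
    obtain ⟨r, r0, hr⟩ := hloc p hp
    refine Filter.Eventually.filter_mono nhdsWithin_le_nhds ?_
    filter_upwards [Metric.ball_mem_nhds p r0] with q hq
    have hsub := hr
    rw [← ball_prod_same p.1 p.2 r] at hsub
    have hq2 : q.2 ∈ Metric.ball p.2 r := by
      rw [← ball_prod_same p.1 p.2 r] at hq; exact hq.2
    refine ⟨Metric.ball p.2 r, fun y => f (p.1, y), Metric.isOpen_ball,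
      (convex_ball _ _).ordConnected, Metric.mem_ball_self r0, hq2, fun y hy =>
      analyticAt_slice_snd (hf _ (hsub ⟨Metric.mem_ball_self r0, hy⟩)), ?_, ?_⟩
    · exact Filter.eventuallyEq_of_mem (Metric.ball_mem_nhds p r0)
        fun s hs => eq_of_dirD_fst_eq_zero hf h0 hr hs
    · exact Filter.eventuallyEq_of_mem (Metric.isOpen_ball.mem_nhds hq)
        fun s hs => eq_of_dirD_fst_eq_zero hf h0 hr hs
  have hval : ∀ p ∈ V, ∀ q ∈ V, p.2 = q.2 → f p = f q := by
    intro p hp q hq hpq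
    obtain ⟨J, θ, -, -, -, -, -, fp, fq⟩ := hglob p hp q hq
    rw [fp.eq_of_nhds, fq.eq_of_nhds, hpq]
  -- The value `0` off the projection of `V` is arbitrary. Analyticity is checked below by
  -- comparison with a slice of `f` through a point of `V`.
  let θ : ℝ → ℝ := fun y => if h : ∃ x, (x, y) ∈ V then f (h.choose, y) else 0
  have hθ : ∀ p ∈ V, f p = θ p.2 := by
    intro p hp
    have h : ∃ x, (x, p.2) ∈ V := ⟨p.1, hp⟩
    have : θ p.2 = f (h.choose, p.2) := dif_pos h
    rw [this]
    exact hval p hp _ h.choose_spec rfl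
  refine ⟨θ, ?_, hθ⟩
  rintro _ ⟨p, hp, rfl⟩
  refine (analyticAt_slice_snd (x := p.1) (hf p hp)).congr ?_
  have hc : Filter.Tendsto (fun y : ℝ => (p.1, y)) (nhds p.2) (nhds p) :=
    (Continuous.prodMk_right p.1).tendsto p.2
  filter_upwards [hc.eventually (hVo.mem_nhds hp)] with y hy
  exact hθ _ hy

theorem exists_comp_fst {V : Set (ℝ × ℝ)} (hVo : IsOpen V) (hVc : IsPreconnected V)
    {f : ℝ × ℝ → ℝ} (hf : AnalyticOnNhd ℝ f V) (h0 : ∀ p ∈ V, dirD (0, 1) f p = 0) :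
    ∃ θ : ℝ → ℝ, AnalyticOnNhd ℝ θ (Prod.fst '' V) ∧ ∀ p ∈ V, f p = θ p.1 := by
  let e := ContinuousLinearEquiv.prodComm ℝ ℝ ℝ
  have hpre : e ⁻¹' V = e.symm '' V := by
    rw [e.symm.image_eq_preimage_symm]; rfl
  obtain ⟨θ, h1, h2⟩ := exists_comp_snd (V := e ⁻¹' V) (hVo.preimage e.continuous)
    (by rw [hpre]; exact hVc.image _ e.symm.continuous.continuousOn) (f := fun p => f (e p))
    (fun p hp => (hf (e p) hp).comp (e.toContinuousLinearMap.analyticAt p))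
    (fun p hp => by
      have := ((hf (e p) hp).differentiableAt.hasFDerivAt.comp p
        e.toContinuousLinearMap.hasFDerivAt).fderiv
      change fderiv ℝ (f ∘ e) p (1, 0) = 0
      rw [this]
      exact h0 (e p) hp)
  refine ⟨θ, ?_, fun p hp => ?_⟩
  · rintro _ ⟨p, hp, rfl⟩
    exact h1 p.1 ⟨p.swap, hp, rfl⟩
  · exact h2 p.swap hp

theorem exists_rho {J : Set ℝ} {θ : ℝ → ℝ} (hθ : AnalyticOnNhd ℝ θ J)
    (hs : ∀ y ∈ J, sin (θ y) ≠ 0) (hc : ∀ y ∈ J, cos (θ y) ≠ 0) :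
    ∃ ρ : ℝ → ℝ, AnalyticOnNhd ℝ ρ J ∧ ∀ y ∈ J,
      exp (2 * ρ y) = (sin (θ y) / cos (θ y)) ^ 2 ∧
      deriv ρ y = deriv θ y / (sin (θ y) * cos (θ y)) := by
  -- `ρ = log |tan θ|`; the square avoids a choice of sign.
  refine ⟨fun y => (1 / 2) * log ((sin (θ y) / cos (θ y)) ^ 2), fun y hy => ?_, fun y hy => ?_⟩
  · have h1 := analyticAt_sin.comp (hθ y hy)
    have h2 := analyticAt_cos.comp (hθ y hy)
    have hpos : 0 < (sin (θ y) / cos (θ y)) ^ 2 := by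
      have := div_ne_zero (hs y hy) (hc y hy); positivity
    exact analyticAt_const.mul (((h1.div h2 (hc y hy)).pow 2).log hpos)
  · have hs := hs y hy
    have hc := hc y hy
    have hpos : 0 < (sin (θ y) / cos (θ y)) ^ 2 := by
      have := div_ne_zero hs hc; positivity
    refine ⟨?_, ?_⟩
    · rw [← mul_assoc, mul_one_div_cancel two_ne_zero, one_mul, exp_log hpos]
    · have hd := (hθ y hy).differentiableAt.hasDerivAt
      have := (((hd.sin.fun_div hd.cos hc).fun_pow 2).log hpos.ne').const_mul (1 / 2)
      refine this.deriv.trans ?_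
      have hsc := sin_sq_add_cos_sq (θ y)
      push_cast
      field_simp
      linear_combination deriv θ y * hsc

theorem exists_pos_multiple {J : Set ℝ} (hJ : IsPreconnected J) (hne : J.Nonempty) {σ : ℝ → ℝ}
    (hσ : AnalyticOnNhd ℝ σ J) (h0 : ∀ x ∈ J, σ x ≠ 0) :
    ∃ (t : ℝ) (τ : ℝ → ℝ), t ≠ 0 ∧ AnalyticOnNhd ℝ τ J ∧ ∀ x ∈ J, 0 < τ x ∧ σ x = t * τ x := by
  obtain ⟨x₀, hx₀⟩ := hne
  have ht := h0 x₀ hx₀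
  -- Dividing by the value at one point absorbs the sign into `t`: the quotient is `1` at `x₀` and
  -- has no zero, hence is positive by the intermediate value theorem.
  refine ⟨σ x₀, fun x => σ x / σ x₀, ht, fun x hx => (hσ x hx).div analyticAt_const ht,
    fun x hx => ⟨?_, by field_simp⟩⟩
  have hcont : ContinuousOn (fun x => σ x / σ x₀) J := fun y hy =>
    ((hσ y hy).continuousAt.div_const _).continuousWithinAt
  by_contra hneg
  obtain ⟨z, hz, hz0⟩ := hJ.intermediate_value hx hx₀ hcont
    (show (0 : ℝ) ∈ Icc _ _ from ⟨not_lt.1 hneg, by simp [div_self ht]⟩)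
  exact h0 z hz ((div_eq_zero_iff.1 hz0).resolve_right ht)

/-! ### The plane data in terms of `tan φ` and `cot φ` -/

theorem tan_mul_cot_eq_one {t : ℝ} (hs : sin t ≠ 0) (hc : cos t ≠ 0) : tan t * cot t = 1 := by
  rw [tan_eq_sin_div_cos, cot_eq_cos_div_sin]; field_simp

theorem one_add_tan_sq {t : ℝ} (hc : cos t ≠ 0) : 1 / cos t ^ 2 = 1 + tan t ^ 2 := by
  have := sin_sq_add_cos_sq t
  rw [tan_eq_sin_div_cos]; field_simp; linarith

theorem one_add_cot_sq {t : ℝ} (hs : sin t ≠ 0) : 1 / sin t ^ 2 = 1 + cot t ^ 2 := by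
  have := sin_sq_add_cos_sq t
  rw [cot_eq_cos_div_sin]; field_simp; linarith

theorem cos_two_mul_div_cos_sq {t : ℝ} (hc : cos t ≠ 0) :
    cos (2 * t) / cos t ^ 2 = 1 - tan t ^ 2 := by
  rw [tan_eq_sin_div_cos, cos_two_mul']; field_simp

theorem cos_two_mul_div_sin_sq {t : ℝ} (hs : sin t ≠ 0) :
    cos (2 * t) / sin t ^ 2 = cot t ^ 2 - 1 := by
  rw [cot_eq_cos_div_sin, cos_two_mul']; field_simp

theorem cos_two_mul_eq_tan {t : ℝ} (hc : cos t ≠ 0) :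
    cos (2 * t) = (1 - tan t ^ 2) / (1 + tan t ^ 2) := by
  rw [← one_add_tan_sq hc, ← cos_two_mul_div_cos_sq hc]; field_simp

theorem sin_two_mul_eq_tan {t : ℝ} (hc : cos t ≠ 0) :
    sin (2 * t) = 2 * tan t / (1 + tan t ^ 2) := by
  rw [← one_add_tan_sq hc, tan_eq_sin_div_cos, sin_two_mul]; field_simp

/-! ### Derivatives and analyticity of `tan φ` and `cot φ` -/

section Trig

variable {X : Type*} [NormedAddCommGroup X] [NormedSpace ℝ X]

theorem dirD_comp (v : X) {f : X → ℝ} {g : ℝ → ℝ} {g' : ℝ} {p : X}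
    (hf : DifferentiableAt ℝ f p) (hg : HasDerivAt g g' (f p)) :
    dirD v (fun q => g (f q)) p = g' * dirD v f p := by
  have := (hg.comp_hasFDerivAt p hf.hasFDerivAt).fderiv
  change fderiv ℝ (g ∘ f) p v = _
  rw [this]; rfl

theorem hasDerivAt_cot {t : ℝ} (hs : sin t ≠ 0) : HasDerivAt cot (-(1 + cot t ^ 2)) t := by
  have h := (hasDerivAt_cos t).fun_div (hasDerivAt_sin t) hs
  have e : cot = fun t => cos t / sin t := funext cot_eq_cos_div_sin
  rw [e]
  refine h.congr_deriv ?_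
  field_simp
  ring

theorem dirD_tan (v : X) {f : X → ℝ} {p : X} (hf : DifferentiableAt ℝ f p)
    (hc : cos (f p) ≠ 0) :
    dirD v (fun q => tan (f q)) p = (1 + tan (f p) ^ 2) * dirD v f p := by
  rw [← one_add_tan_sq hc]; exact dirD_comp v hf (hasDerivAt_tan hc)

theorem dirD_cot (v : X) {f : X → ℝ} {p : X} (hf : DifferentiableAt ℝ f p)
    (hs : sin (f p) ≠ 0) :
    dirD v (fun q => cot (f q)) p = -((1 + cot (f p) ^ 2) * dirD v f p) := by
  rw [dirD_comp v hf (hasDerivAt_cot hs), neg_mul]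

theorem analyticAt_tan_comp {f : X → ℝ} {p : X} (hf : AnalyticAt ℝ f p) (hc : cos (f p) ≠ 0) :
    AnalyticAt ℝ (fun q => tan (f q)) p := by
  simp only [tan_eq_sin_div_cos]
  exact (analyticAt_sin.comp hf).div (analyticAt_cos.comp hf) hc

theorem analyticAt_cot_comp {f : X → ℝ} {p : X} (hf : AnalyticAt ℝ f p) (hs : sin (f p) ≠ 0) :
    AnalyticAt ℝ (fun q => cot (f q)) p := by
  simp only [cot_eq_cos_div_sin]
  exact (analyticAt_cos.comp hf).div (analyticAt_sin.comp hf) hs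

end Trig

theorem dx_eq_dirD : dx = dirD (1, 0) := rfl

theorem dy_eq_dirD : dy = dirD (0, 1) := rfl

section Plane

variable {V : Set (ℝ × ℝ)} {E G : ℝ × ℝ → ℝ} {d : InitialData}

/-- Positivity of `E` and `G` is what keeps `φ_zx` and `φ_zy` away from zero; the derivatives of
`ψ_z` are used only through their integrability condition. -/
theorem IsDeterminedBy.determinedData (hV : IsOpen V) (hm : IsHyperbolicMetric V E G)
    (H : IsDeterminedBy V E G d) :
    DeterminedData V (1, 0) (0, 1) d.φ d.φz (fun p => tan (d.φ p)) (fun p => cot (d.φ p))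
      d.φzz d.ψzz := by
  have aT : AnalyticOnNhd ℝ (fun p => tan (d.φ p)) V := fun p hp =>
    analyticAt_tan_comp (H.analytic_φ p hp) (H.cos_ne p hp)
  have aC : AnalyticOnNhd ℝ (fun p => cot (d.φ p)) V := fun p hp =>
    analyticAt_cot_comp (H.analytic_φ p hp) (H.sin_ne p hp)
  have aφa := analyticOnNhd_dirD (analyticOnNhd_dirD H.analytic_φ (1, 0)) (1, 0)
  have aφb := analyticOnNhd_dirD (analyticOnNhd_dirD H.analytic_φ (0, 1)) (0, 1)
  have aψa := analyticOnNhd_dirD (analyticOnNhd_dirD H.analytic_ψ (1, 0)) (1, 0)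
  have aψb := analyticOnNhd_dirD (analyticOnNhd_dirD H.analytic_ψ (0, 1)) (0, 1)
  have acos : AnalyticOnNhd ℝ (fun p => cos (2 * d.φ p)) V := fun p hp =>
    analyticAt_cos.comp (analyticAt_const.mul (H.analytic_φ p hp))
  have asin : AnalyticOnNhd ℝ (fun p => sin (2 * d.φ p)) V := fun p hp =>
    analyticAt_sin.comp (analyticAt_const.mul (H.analytic_φ p hp))
  have hψa : ∀ p ∈ V, dirD (1, 0) d.ψz p = -(dirD (1, 0) d.φz p * cot (d.φ p)) := fun p hp => by
    have h := H.ψz_x p hp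
    have hw := H.φz_ne p hp
    have hs := H.sin_ne p hp
    have hc := H.cos_ne p hp
    rw [dx_eq_dirD] at h
    rw [cot_eq_cos_div_sin]
    field_simp at h ⊢
    linear_combination h
  have hψb : ∀ p ∈ V, dirD (0, 1) d.ψz p = dirD (0, 1) d.φz p * tan (d.φ p) := fun p hp => by
    have h := H.ψz_y p hp
    have hw := H.φz_ne p hp
    have hs := H.sin_ne p hp
    have hc := H.cos_ne p hp
    rw [dy_eq_dirD] at h
    rw [tan_eq_sin_div_cos]
    field_simp at h ⊢
    linear_combination h
  exact {
    isOpen := hV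
    an_φ := H.analytic_φ
    an_w := H.analytic_φz
    an_T := aT
    an_C := aC
    an_Z := ((aφa.sub aφb).mul acos).add ((aψa.sub aψb).mul asin)
    an_W := ((aφa.sub aφb).mul asin).sub ((aψa.sub aψb).mul acos)
    TC := fun p hp => tan_mul_cot_eq_one (H.sin_ne p hp) (H.cos_ne p hp)
    DT := fun v p hp => dirD_tan v (H.analytic_φ p hp).differentiableAt (H.cos_ne p hp)
    DC := fun v p hp => dirD_cot v (H.analytic_φ p hp).differentiableAt (H.sin_ne p hp)
    wa_ne := fun p hp h => by
      have h1 := hm.pos_E p hp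
      rw [H.metric_x p hp, dx_eq_dirD, h] at h1
      simp at h1
    wb_ne := fun p hp h => by
      have h1 := hm.pos_G p hp
      rw [H.metric_y p hp, dy_eq_dirD, h] at h1
      simp at h1
    wab := fun p hp => by
      have e1 := dirD_congr hV hψa (0, 1) hp
      have e2 := dirD_congr hV hψb (1, 0) hp
      have dT := (aT p hp).differentiableAt
      have dC := (aC p hp).differentiableAt
      have dwa := (analyticOnNhd_dirD H.analytic_φz (1, 0) p hp).differentiableAt
      have dwb := (analyticOnNhd_dirD H.analytic_φz (0, 1) p hp).differentiableAt
      have dφ := (H.analytic_φ p hp).differentiableAt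
      rw [dirD_comm_of_analytic (H.analytic_ψz p hp), e2, dirD_mul _ dwb dT, dirD_neg,
        dirD_mul _ dwa dC, dirD_tan _ dφ (H.cos_ne p hp), dirD_cot _ dφ (H.sin_ne p hp),
        dirD_comm_of_analytic (H.analytic_φz p hp)] at e1
      linear_combination e1
    lap := fun p hp => by
      simp only [InitialData.φzz, InitialData.ψzz, InitialData.Lφ, InitialData.Lψ, dx_eq_dirD,
        dy_eq_dirD, cos_two_mul_eq_tan (H.cos_ne p hp), sin_two_mul_eq_tan (H.cos_ne p hp)]
      have h2 : 1 + tan (d.φ p) ^ 2 ≠ 0 := by positivity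
      field_simp
      ring
    compat_a := fun p hp => by
      have h := H.compat_x p hp
      simp only [dx_eq_dirD] at h
      rw [← one_add_cot_sq (H.sin_ne p hp)]
      linear_combination h
    compat_b := fun p hp => by
      have h := H.compat_y p hp
      simp only [dy_eq_dirD] at h
      rw [← one_add_tan_sq (H.cos_ne p hp)]
      linear_combination h }

theorem barKappa3_eq_dirKappa3 (H : IsDeterminedBy V E G d) (h k : ℝ × ℝ → ℝ) {p : ℝ × ℝ}
    (hp : p ∈ V) : barKappa3 d h k p =
      dirKappa3 (1, 0) (0, 1) d.φ d.φz (fun p => tan (d.φ p)) (fun p => cot (d.φ p)) d.φzz h k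
        p := by
  simp only [barKappa3, dirKappa3, dx_eq_dirD, dy_eq_dirD,
    cos_two_mul_div_cos_sq (H.cos_ne p hp), cos_two_mul_div_sin_sq (H.sin_ne p hp)]

theorem barPsiZZ_eq_ψzz (H : IsDeterminedBy V E G d) {p : ℝ × ℝ} (hp : p ∈ V) :
    barPsiZZ d p = d.ψzz p := by
  have hs : sin (2 * d.φ p) ≠ 0 := by
    rw [sin_two_mul]
    exact mul_ne_zero (mul_ne_zero two_ne_zero (H.sin_ne p hp)) (H.cos_ne p hp)
  rw [barPsiZZ, div_eq_iff hs]
  simp only [InitialData.φzz, InitialData.ψzz, InitialData.Lφ, InitialData.Lψ]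
  linear_combination (-(dx (dx d.φ) p - dy (dy d.φ) p)) * sin_sq_add_cos_sq (2 * d.φ p)

theorem barHZZ_eq_dirHZZ (H : IsDeterminedBy V E G d) (h : ℝ × ℝ → ℝ) {p : ℝ × ℝ}
    (hp : p ∈ V) : barHZZ d h p =
      dirHZZ (1, 0) (0, 1) d.φ (fun p => tan (d.φ p)) (fun p => cot (d.φ p)) d.ψzz h p := by
  simp only [barHZZ, dirHZZ, barPsiZZ_eq_ψzz H hp, dx_eq_dirD, dy_eq_dirD]

theorem IsInitialSolution.solvesInitialSystem (H : IsDeterminedBy V E G d) {h k : ℝ × ℝ → ℝ}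
    (S : IsInitialSolution V d h k) (ah : AnalyticOnNhd ℝ h V) (ak : AnalyticOnNhd ℝ k V)
    (hpos : ∀ p ∈ V, 0 < h p) :
    SolvesInitialSystem V (1, 0) (0, 1) d.φ d.φz (fun p => tan (d.φ p)) (fun p => cot (d.φ p))
      d.φzz d.ψzz h k where
  an_h := ah
  an_k := ak
  pos := hpos
  hab p hp := by
    have e := S.eq_xy p hp
    simp only [dx_eq_dirD, dy_eq_dirD] at e
    linear_combination e
  ka p hp := by
    have e := S.eq_xz p hp
    simp only [dx_eq_dirD] at e
    linear_combination e
  kb p hp := by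
    have e := S.eq_yz p hp
    simp only [dy_eq_dirD] at e
    linear_combination e
  zeta p hp := by
    have e := S.eq_zeta p hp
    rw [barKappa3_eq_dirKappa3 H h k hp] at e
    rw [e, barZeta, barHZZ_eq_dirHZZ H h hp, ← one_add_tan_sq (H.cos_ne p hp),
      ← one_add_cot_sq (H.sin_ne p hp)]
    simp only [dx_eq_dirD, dy_eq_dirD]
    ring

/-! ### Special metrics -/

theorem dirD_comp_fst {σ : ℝ → ℝ} {p : ℝ × ℝ} (hσ : DifferentiableAt ℝ σ p.1) (v : ℝ × ℝ) :
    dirD v (fun q => σ q.1) p = deriv σ p.1 * v.1 := by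
  rw [dirD_comp v (f := Prod.fst) differentiableAt_fst hσ.hasDerivAt]
  simp [dirD, fderiv_fst]

theorem dirD_comp_snd {σ : ℝ → ℝ} {p : ℝ × ℝ} (hσ : DifferentiableAt ℝ σ p.2) (v : ℝ × ℝ) :
    dirD v (fun q => σ q.2) p = deriv σ p.2 * v.2 := by
  rw [dirD_comp v (f := Prod.snd) differentiableAt_snd hσ.hasDerivAt]
  simp [dirD, fderiv_snd]

/-- By `dirD_w_eq` the quotient `φ_z / sin φ` has vanishing `y`-derivative, so up to the constant
`t` it is the function `σ(x)`, while `e^ρ = |tan φ|`. The derivatives of `ρ` and `σ` cannot vanish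
because `φ_zy` and `φ_zx` do not. -/
theorem IsDeterminedBy.isSpecialY (hVo : IsOpen V) (hVc : IsConnected V)
    (hm : IsHyperbolicMetric V E G) (H : IsDeterminedBy V E G d)
    (hφ : ∀ p ∈ V, dirD (1, 0) d.φ p = 0) : IsSpecialY V E G d.φ d.φz := by
  have D := H.determinedData hVo hm
  have hw : ∀ p ∈ V, dirD (0, 1) d.φz p = d.φz p * dirD (0, 1) d.φ p * cot (d.φ p) :=
    fun p hp => dirD_w_eq D hφ hp
  obtain ⟨θ, aθ, hθ⟩ := exists_comp_snd hVo hVc.isPreconnected H.analytic_φ hφ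
  have aq : AnalyticOnNhd ℝ (fun p => d.φz p / sin (d.φ p)) V := fun p hp =>
    (H.analytic_φz p hp).div (analyticAt_sin.comp (H.analytic_φ p hp)) (H.sin_ne p hp)
  have hmul : ∀ p ∈ V, d.φz p = d.φz p / sin (d.φ p) * sin (d.φ p) := fun p hp =>
    (div_mul_cancel₀ _ (H.sin_ne p hp)).symm
  have dsin : ∀ p ∈ V, ∀ v, dirD v (fun q => sin (d.φ q)) p = cos (d.φ p) * dirD v d.φ p :=
    fun p hp v => dirD_comp v (H.analytic_φ p hp).differentiableAt (hasDerivAt_sin _)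
  have dφsin : ∀ p ∈ V, DifferentiableAt ℝ (fun q => sin (d.φ q)) p := fun p hp =>
    (analyticAt_sin.comp (H.analytic_φ p hp)).differentiableAt
  obtain ⟨σ₀, aσ₀, hσ₀⟩ := exists_comp_fst hVo hVc.isPreconnected aq (fun p hp => by
    have e := dirD_congr hVo hmul (0, 1) hp
    rw [dirD_mul _ (aq p hp).differentiableAt (dφsin p hp), dsin p hp, hw p hp,
      cot_eq_cos_div_sin] at e
    have hs := H.sin_ne p hp
    apply mul_left_cancel₀ hs
    linear_combination (norm := (field_simp; ring)) -e)
  have hne : ∀ x ∈ Prod.fst '' V, σ₀ x ≠ 0 := by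
    rintro _ ⟨p, hp, rfl⟩
    rw [← hσ₀ p hp]
    exact div_ne_zero (H.φz_ne p hp) (H.sin_ne p hp)
  obtain ⟨t, σ, ht, aσ, hσ⟩ := exists_pos_multiple
    (hVc.isPreconnected.image _ continuous_fst.continuousOn) (hVc.nonempty.image _) aσ₀ hne
  have hsinθ : ∀ y ∈ Prod.snd '' V, sin (θ y) ≠ 0 := by
    rintro _ ⟨p, hp, rfl⟩
    rw [← hθ p hp]; exact H.sin_ne p hp
  have hcosθ : ∀ y ∈ Prod.snd '' V, cos (θ y) ≠ 0 := by
    rintro _ ⟨p, hp, rfl⟩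
    rw [← hθ p hp]; exact H.cos_ne p hp
  obtain ⟨ρ, aρ, hρ⟩ := exists_rho aθ hsinθ hcosθ
  have hwσ : ∀ p ∈ V, d.φz p = t * σ p.1 * sin (d.φ p) := fun p hp => by
    rw [hmul p hp, hσ₀ p hp, (hσ p.1 ⟨p, hp, rfl⟩).2]
  have hwx : ∀ p ∈ V, dirD (1, 0) d.φz p = t * deriv σ p.1 * sin (d.φ p) := fun p hp => by
    have dσ := (aσ p.1 ⟨p, hp, rfl⟩).differentiableAt
    have dσ' : DifferentiableAt ℝ (fun q : ℝ × ℝ => σ q.1) p := dσ.comp p differentiableAt_fst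
    rw [dirD_congr hVo hwσ (1, 0) hp, dirD_mul _ (dσ'.const_mul t) (dφsin p hp),
      dirD_mul _ (differentiableAt_const t) dσ', dirD_comp_fst dσ, dsin p hp, hφ p hp, dirD_const]
    ring
  have hφy : ∀ p ∈ V, dirD (0, 1) d.φ p = deriv θ p.2 := fun p hp => by
    rw [dirD_congr hVo hθ (0, 1) hp, dirD_comp_snd (aθ p.2 ⟨p, hp, rfl⟩).differentiableAt, mul_one]
  refine ⟨θ, ρ, σ, t, ht, aθ, aρ, ?_, aσ, ?_, fun p hp => ?_⟩
  · rintro _ ⟨p, hp, rfl⟩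
    have hy : p.2 ∈ Prod.snd '' V := ⟨p, hp, rfl⟩
    rw [(hρ _ hy).2]
    refine div_ne_zero (fun h => D.wb_ne p hp ?_) (mul_ne_zero (hsinθ _ hy) (hcosθ _ hy))
    rw [hw p hp, hφy p hp, h, mul_zero, zero_mul]
  · rintro _ ⟨p, hp, rfl⟩
    refine ⟨(hσ p.1 ⟨p, hp, rfl⟩).1, fun h => D.wa_ne p hp ?_⟩
    rw [hwx p hp, h, mul_zero, zero_mul]
  · have hy : p.2 ∈ Prod.snd '' V := ⟨p, hp, rfl⟩
    have hs := H.sin_ne p hp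
    have hc := H.cos_ne p hp
    have hσp := (hσ p.1 ⟨p, hp, rfl⟩).1.ne'
    have hsc := sin_sq_add_cos_sq (d.φ p)
    have hw0 := H.φz_ne p hp
    have hexp := (hρ _ hy).1
    have hdρ := (hρ _ hy).2
    rw [← hθ p hp] at hexp hdρ
    have hsum : 1 + exp (2 * ρ p.2) = 1 / cos (d.φ p) ^ 2 := by
      rw [hexp]; field_simp; linarith
    refine ⟨hθ p hp, ?_, ?_, hwσ p hp, ?_, ?_⟩
    · rw [hsum]; field_simp
    · rw [hsum, hexp]; field_simp
    · rw [H.metric_x p hp, dx_eq_dirD, hwx p hp, hwσ p hp, exp_neg, hexp]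
      field_simp
      rw [hsc, mul_one]
    · rw [H.metric_y p hp, dy_eq_dirD, hw p hp, hφy p hp, hsum, hdρ, cot_eq_cos_div_sin]
      field_simp

theorem IsDeterminedBy.isSpecialX (hVo : IsOpen V) (hVc : IsConnected V)
    (hm : IsHyperbolicMetric V E G) (H : IsDeterminedBy V E G d)
    (hφ : ∀ p ∈ V, dirD (0, 1) d.φ p = 0) : IsSpecialX V E G d.φ d.φz := by
  have D := H.determinedData hVo hm
  have hw : ∀ p ∈ V, dirD (1, 0) d.φz p = -(d.φz p * dirD (1, 0) d.φ p * tan (d.φ p)) :=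
    fun p hp => by
      have e := dirD_w_eq D.swap (fun q hq => by rw [dirD_neg, hφ q hq, neg_zero]) hp
      simp only [dirD_neg_fun] at e
      linear_combination -e
  obtain ⟨θ, aθ, hθ⟩ := exists_comp_fst hVo hVc.isPreconnected H.analytic_φ hφ
  have aq : AnalyticOnNhd ℝ (fun p => d.φz p / cos (d.φ p)) V := fun p hp =>
    (H.analytic_φz p hp).div (analyticAt_cos.comp (H.analytic_φ p hp)) (H.cos_ne p hp)
  have hmul : ∀ p ∈ V, d.φz p = d.φz p / cos (d.φ p) * cos (d.φ p) := fun p hp =>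
    (div_mul_cancel₀ _ (H.cos_ne p hp)).symm
  have dcos : ∀ p ∈ V, ∀ v, dirD v (fun q => cos (d.φ q)) p = -sin (d.φ p) * dirD v d.φ p :=
    fun p hp v => dirD_comp v (H.analytic_φ p hp).differentiableAt (hasDerivAt_cos _)
  have dφcos : ∀ p ∈ V, DifferentiableAt ℝ (fun q => cos (d.φ q)) p := fun p hp =>
    (analyticAt_cos.comp (H.analytic_φ p hp)).differentiableAt
  obtain ⟨σ₀, aσ₀, hσ₀⟩ := exists_comp_snd hVo hVc.isPreconnected aq (fun p hp => by
    have e := dirD_congr hVo hmul (1, 0) hp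
    rw [dirD_mul _ (aq p hp).differentiableAt (dφcos p hp), dcos p hp, hw p hp,
      tan_eq_sin_div_cos] at e
    have hc := H.cos_ne p hp
    apply mul_left_cancel₀ hc
    linear_combination (norm := (field_simp; ring)) -e)
  have hne : ∀ x ∈ Prod.snd '' V, σ₀ x ≠ 0 := by
    rintro _ ⟨p, hp, rfl⟩
    rw [← hσ₀ p hp]
    exact div_ne_zero (H.φz_ne p hp) (H.cos_ne p hp)
  obtain ⟨t, σ, ht, aσ, hσ⟩ := exists_pos_multiple
    (hVc.isPreconnected.image _ continuous_snd.continuousOn) (hVc.nonempty.image _) aσ₀ hne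
  have hsinθ : ∀ x ∈ Prod.fst '' V, sin (π / 2 - θ x) ≠ 0 := by
    rintro _ ⟨p, hp, rfl⟩
    rw [sin_pi_div_two_sub, ← hθ p hp]; exact H.cos_ne p hp
  have hcosθ : ∀ x ∈ Prod.fst '' V, cos (π / 2 - θ x) ≠ 0 := by
    rintro _ ⟨p, hp, rfl⟩
    rw [cos_pi_div_two_sub, ← hθ p hp]; exact H.sin_ne p hp
  -- After the exchange of coordinates `e^ρ` is `|cot φ|`, that is `|tan|` of `π / 2 - φ`.
  obtain ⟨ρ, aρ, hρ⟩ := exists_rho (θ := fun x => π / 2 - θ x)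
    (fun x hx => analyticAt_const.sub (aθ x hx)) hsinθ hcosθ
  have hwσ : ∀ p ∈ V, d.φz p = t * σ p.2 * cos (d.φ p) := fun p hp => by
    rw [hmul p hp, hσ₀ p hp, (hσ p.2 ⟨p, hp, rfl⟩).2]
  have hwy : ∀ p ∈ V, dirD (0, 1) d.φz p = t * deriv σ p.2 * cos (d.φ p) := fun p hp => by
    have dσ := (aσ p.2 ⟨p, hp, rfl⟩).differentiableAt
    have dσ' : DifferentiableAt ℝ (fun q : ℝ × ℝ => σ q.2) p := dσ.comp p differentiableAt_snd
    rw [dirD_congr hVo hwσ (0, 1) hp, dirD_mul _ (dσ'.const_mul t) (dφcos p hp),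
      dirD_mul _ (differentiableAt_const t) dσ', dirD_comp_snd dσ, dcos p hp, hφ p hp, dirD_const]
    ring
  have hφx : ∀ p ∈ V, dirD (1, 0) d.φ p = deriv θ p.1 := fun p hp => by
    rw [dirD_congr hVo hθ (1, 0) hp, dirD_comp_fst (aθ p.1 ⟨p, hp, rfl⟩).differentiableAt, mul_one]
  refine ⟨θ, ρ, σ, t, ht, aθ, aρ, ?_, aσ, ?_, fun p hp => ?_⟩
  · rintro _ ⟨p, hp, rfl⟩
    have hx : p.1 ∈ Prod.fst '' V := ⟨p, hp, rfl⟩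
    rw [(hρ _ hx).2]
    refine div_ne_zero (fun h => D.wa_ne p hp ?_) (mul_ne_zero (hsinθ _ hx) (hcosθ _ hx))
    rw [deriv_const_sub, neg_eq_zero] at h
    rw [hw p hp, hφx p hp, h, mul_zero, zero_mul, neg_zero]
  · rintro _ ⟨p, hp, rfl⟩
    refine ⟨(hσ p.2 ⟨p, hp, rfl⟩).1, fun h => D.wb_ne p hp ?_⟩
    rw [hwy p hp, h, mul_zero, zero_mul]
  · have hx : p.1 ∈ Prod.fst '' V := ⟨p, hp, rfl⟩
    have hs := H.sin_ne p hp
    have hc := H.cos_ne p hp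
    have hσp := (hσ p.2 ⟨p, hp, rfl⟩).1.ne'
    have hsc := sin_sq_add_cos_sq (d.φ p)
    have hw0 := H.φz_ne p hp
    have hexp := (hρ _ hx).1
    have hdρ := (hρ _ hx).2
    rw [sin_pi_div_two_sub, cos_pi_div_two_sub, ← hθ p hp] at hexp hdρ
    rw [deriv_const_sub] at hdρ
    have hsum : 1 + exp (2 * ρ p.1) = 1 / sin (d.φ p) ^ 2 := by
      rw [hexp]; field_simp; linarith
    refine ⟨hθ p hp, ?_, ?_, hwσ p hp, ?_, ?_⟩
    · rw [hsum]; field_simp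
    · rw [hsum, hexp]; field_simp
    · rw [H.metric_y p hp, dy_eq_dirD, hwy p hp, hwσ p hp, exp_neg, hexp]
      field_simp
      rw [add_comm, hsc, mul_one]
    · rw [H.metric_x p hp, dx_eq_dirD, hw p hp, hφx p hp, hsum, hdρ, tan_eq_sin_div_cos]
      field_simp

end Plane

/-- Near a point where `f` does not vanish, `g` is zero, and the identity theorem propagates this
over the connected domain. -/
theorem eq_zero_or_eq_zero_of_analytic_mul {V : Set (ℝ × ℝ)} (hVo : IsOpen V) (hVc : IsPreconnected V)
    {f g : ℝ × ℝ → ℝ} (hf : AnalyticOnNhd ℝ f V) (hg : AnalyticOnNhd ℝ g V)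
    (h : ∀ p ∈ V, f p * g p = 0) : (∀ p ∈ V, f p = 0) ∨ ∀ p ∈ V, g p = 0 := by
  by_contra! hcon
  obtain ⟨⟨p, hp, hfp⟩, q, hq, hgq⟩ := hcon
  refine hgq (hg.eqOn_zero_of_preconnected_of_eventuallyEq_zero hVc hp ?_ hq)
  filter_upwards [(hf p hp).continuousAt.eventually_ne hfp, hVo.mem_nhds hp] with r h1 h2
  exact (mul_eq_zero.1 (h r h2)).resolve_left h1

theorem analyticOnNhd_dirKappa3 {X : Type*} [NormedAddCommGroup X] [NormedSpace ℝ X] {U : Set X}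
    {a b : X} {φ w T C Z W h k : X → ℝ} (D : DeterminedData U a b φ w T C Z W)
    (S : SolvesInitialSystem U a b φ w T C Z W h k) :
    AnalyticOnNhd ℝ (dirKappa3 a b φ w T C Z h k) U := fun p hp => by
  have aφ := D.an_φ
  have ah := S.an_h
  have h1 := D.an_T p hp
  have h2 := D.an_C p hp
  have h3 := D.an_w p hp
  have h4 := D.an_Z p hp
  have h5 := ah p hp
  have h6 := S.an_k p hp
  have h7 := analyticOnNhd_dirD aφ a p hp
  have h8 := analyticOnNhd_dirD aφ b p hp
  have h9 := analyticOnNhd_dirD ah a p hp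
  have h10 := analyticOnNhd_dirD ah b p hp
  have h11 := analyticOnNhd_dirD (analyticOnNhd_dirD ah a) a p hp
  have h12 := analyticOnNhd_dirD (analyticOnNhd_dirD ah b) b p hp
  unfold dirKappa3
  fun_prop

/-! ### Restriction to the slice `z = 0` -/

theorem Dx_eq_dirD : Dx = dirD ((1, 0), 0) := rfl

theorem Dy_eq_dirD : Dy = dirD ((0, 1), 0) := rfl

theorem Dz_eq_dirD : Dz = dirD ((0, 0), 1) := rfl

section Slice

variable {V : Set (ℝ × ℝ)} {I : Set ℝ}

theorem dirD_slice (hV : IsOpen V) {f : (ℝ × ℝ) × ℝ → ℝ} {g : ℝ × ℝ → ℝ}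
    (hfg : ∀ p ∈ V, f (p, 0) = g p) {p : ℝ × ℝ} (hp : p ∈ V) (hf : DifferentiableAt ℝ f (p, 0))
    (v : ℝ × ℝ) : dirD (v, 0) f (p, 0) = dirD v g p := by
  rw [← dirD_congr hV hfg v hp]
  have h1 : HasFDerivAt (fun q : ℝ × ℝ => (q, (0 : ℝ)))
      ((ContinuousLinearMap.id ℝ (ℝ × ℝ)).prod (0 : ℝ × ℝ →L[ℝ] ℝ)) p :=
    (hasFDerivAt_id p).prodMk (hasFDerivAt_const 0 p)
  have := (HasFDerivAt.comp (f := fun q : ℝ × ℝ => (q, (0 : ℝ))) p hf.hasFDerivAt h1).fderiv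
  change _ = fderiv ℝ (f ∘ fun q : ℝ × ℝ => (q, (0 : ℝ))) p v
  rw [this]; rfl

theorem dirD_dirD_slice (hV : IsOpen V) (hI : IsOpen I) (h0 : (0 : ℝ) ∈ I)
    {f : (ℝ × ℝ) × ℝ → ℝ} (hf : ContDiffOn ℝ ∞ f (V ×ˢ I)) {g : ℝ × ℝ → ℝ}
    (hfg : ∀ p ∈ V, f (p, 0) = g p) {p : ℝ × ℝ} (hp : p ∈ V) (u v : ℝ × ℝ) :
    dirD (u, 0) (dirD (v, 0) f) (p, 0) = dirD u (dirD v g) p := by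
  have hU : IsOpen (V ×ˢ I) := hV.prod hI
  have hd : ∀ {f : (ℝ × ℝ) × ℝ → ℝ}, ContDiffOn ℝ ∞ f (V ×ˢ I) → ∀ p ∈ V,
      DifferentiableAt ℝ f (p, 0) := fun hf p hp =>
    (hf.contDiffAt (hU.mem_nhds ⟨hp, h0⟩)).differentiableAt (by simp)
  exact dirD_slice hV (fun q hq => dirD_slice hV hfg hq (hd hf q hq) v) hp
    (hd (contDiffOn_dirD hU hf _) p hp) u

/-- The `z`-derivative on `z = 0` of `h_bz - h_b w γ + h w_b τ = 0`. -/
theorem dirD_z_slice (hV : IsOpen V) (hI : IsOpen I) (h0 : (0 : ℝ) ∈ I) (b : ℝ × ℝ)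
    {h w τ γ : (ℝ × ℝ) × ℝ → ℝ} (sh : ContDiffOn ℝ ∞ h (V ×ˢ I))
    (sw : ContDiffOn ℝ ∞ w (V ×ˢ I)) (sτ : ContDiffOn ℝ ∞ τ (V ×ˢ I))
    (sγ : ContDiffOn ℝ ∞ γ (V ×ˢ I))
    (heq : ∀ q ∈ V ×ˢ I, dirD (b, 0) (dirD (0, 1) h) q - dirD (b, 0) h q * w q * γ q
      + h q * dirD (b, 0) w q * τ q = 0)
    {h₀ k₀ hzz₀ w₀ Z₀ T₀ C₀ : ℝ × ℝ → ℝ} (hh : ∀ p ∈ V, h (p, 0) = h₀ p)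
    (hk : ∀ p ∈ V, dirD (0, 1) h (p, 0) = k₀ p)
    (hzz : ∀ p ∈ V, dirD (0, 1) (dirD (0, 1) h) (p, 0) = hzz₀ p)
    (hw : ∀ p ∈ V, w (p, 0) = w₀ p) (hwz : ∀ p ∈ V, dirD (0, 1) w (p, 0) = Z₀ p)
    {p : ℝ × ℝ} (hp : p ∈ V) (hτ : τ (p, 0) = T₀ p) (hγ : γ (p, 0) = C₀ p)
    (hτz : dirD (0, 1) τ (p, 0) = (1 + T₀ p ^ 2) * w₀ p)
    (hγz : dirD (0, 1) γ (p, 0) = -((1 + C₀ p ^ 2) * w₀ p)) :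
    dirD b hzz₀ p
      - (dirD b k₀ p * w₀ p * C₀ p + dirD b h₀ p * Z₀ p * C₀ p
        - dirD b h₀ p * w₀ p * ((1 + C₀ p ^ 2) * w₀ p))
      + (k₀ p * dirD b w₀ p * T₀ p + h₀ p * dirD b Z₀ p * T₀ p
        + h₀ p * dirD b w₀ p * ((1 + T₀ p ^ 2) * w₀ p)) = 0 := by
  have hU : IsOpen (V ×ˢ I) := hV.prod hI
  have hq : (p, (0 : ℝ)) ∈ V ×ˢ I := ⟨hp, h0⟩
  have hd : ∀ {f : (ℝ × ℝ) × ℝ → ℝ}, ContDiffOn ℝ ∞ f (V ×ˢ I) → DifferentiableAt ℝ f (p, 0) :=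
    fun hf => (hf.contDiffAt (hU.mem_nhds hq)).differentiableAt (by simp)
  have hc : ∀ {f : (ℝ × ℝ) × ℝ → ℝ}, ContDiffOn ℝ ∞ f (V ×ˢ I) →
      dirD (0, 1) (dirD (b, 0) f) (p, 0) = dirD (b, 0) (dirD (0, 1) f) (p, 0) :=
    fun hf => dirD_comm ((hf.contDiffAt (hU.mem_nhds hq)).of_le (by norm_cast)) _ _
  have sD : ∀ (v) {f : (ℝ × ℝ) × ℝ → ℝ}, ContDiffOn ℝ ∞ f (V ×ˢ I) →
      ContDiffOn ℝ ∞ (dirD v f) (V ×ˢ I) := fun v _ hf => contDiffOn_dirD hU hf v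
  have d1 := hd sh
  have d2 := hd sw
  have d3 := hd sτ
  have d4 := hd sγ
  have d5 := hd (sD (b, 0) sh)
  have d6 := hd (sD (b, 0) sw)
  have d7 := hd (sD (0, 1) sh)
  have d8 := hd (sD (b, 0) (sD (0, 1) sh))
  have e := dirD_congr hU heq (0, 1) hq
  simp (disch := fun_prop) only [dirD_add, dirD_sub, dirD_mul, dirD_const, hc sh, hc sw,
    hc (sD (0, 1) sh)] at e
  rw [dirD_slice hV hzz hp (hd (sD _ (sD _ sh))), dirD_slice hV hh hp d1, dirD_slice hV hk hp d7,
    dirD_slice hV hw hp d2, dirD_slice hV hwz hp (hd (sD _ sw)), hh p hp, hk p hp, hw p hp,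
    hwz p hp, hτ, hγ, hτz, hγz] at e
  linear_combination e

end Slice

/-- The traces on `z = 0` of a Guichard net issuing from `d` and of a member of its set `Ξ`. -/
structure HasSlice (V : Set (ℝ × ℝ)) (I : Set ℝ) (d : InitialData) (φ h : (ℝ × ℝ) × ℝ → ℝ)
    (h₀ k₀ : ℝ × ℝ → ℝ) : Prop where
  isOpen : IsOpen V
  isOpen_I : IsOpen I
  zero_mem : (0 : ℝ) ∈ I
  memMet : MemMet (V ×ˢ I) φ
  memXi : MemXi (V ×ˢ I) φ h
  φ_eq : ∀ p ∈ V, φ (p, 0) = d.φ p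
  φz_eq : ∀ p ∈ V, dirD (0, 1) φ (p, 0) = d.φz p
  φzz_eq : ∀ p ∈ V, dirD (0, 1) (dirD (0, 1) φ) (p, 0) = d.φzz p
  h_eq : ∀ p ∈ V, h (p, 0) = h₀ p
  hz_eq : ∀ p ∈ V, dirD (0, 1) h (p, 0) = k₀ p
  hzz_eq : ∀ p ∈ V, dirD (0, 1) (dirD (0, 1) h) (p, 0) = barHZZ d h₀ p

/-- The evolution equations for `φ` and `h` turn their second `z`-derivatives on `z = 0` into
expressions in the initial data, so a `z`-differentiated equation becomes a condition on the plane.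
-/
theorem IsNetIssuingFrom.hasSlice {V : Set (ℝ × ℝ)} {I : Set ℝ} {d : InitialData}
    {φ h : (ℝ × ℝ) × ℝ → ℝ} {h₀ k₀ : ℝ × ℝ → ℝ} (hV : IsOpen V) (hI : IsOpen I) (h0 : (0 : ℝ) ∈ I)
    (N : IsNetIssuingFrom V I d φ) (M : MemXi (V ×ˢ I) φ h) (hh : ∀ p ∈ V, h (p, 0) = h₀ p)
    (hk : ∀ p ∈ V, Dz h (p, 0) = k₀ p) : HasSlice V I d φ h h₀ k₀ := by
  obtain ⟨hM, ψ, aψ, -, hφzz, htr⟩ := N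
  have sφ : ContDiffOn ℝ ∞ φ (V ×ˢ I) := hM.analytic.contDiffOn_of_completeSpace
  have sψ : ContDiffOn ℝ ∞ ψ (V ×ˢ I) := aψ.contDiffOn_of_completeSpace
  have hU : IsOpen (V ×ˢ I) := hV.prod hI
  have tφ : ∀ p ∈ V, φ (p, 0) = d.φ p := fun p hp => (htr p hp).1
  have tψ : ∀ p ∈ V, ψ (p, 0) = d.ψ p := fun p hp => (htr p hp).2.2.1
  have hd : ∀ {f : (ℝ × ℝ) × ℝ → ℝ}, ContDiffOn ℝ ∞ f (V ×ˢ I) → ∀ p ∈ V,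
      DifferentiableAt ℝ f (p, 0) := fun hf p hp =>
    (hf.contDiffAt (hU.mem_nhds ⟨hp, h0⟩)).differentiableAt (by simp)
  have zz : ∀ p ∈ V, Dz (Dz φ) (p, 0) = d.φzz p := fun p hp => by
    rw [hφzz _ ⟨hp, h0⟩]
    simp only [Dx_eq_dirD, Dy_eq_dirD, dirD_dirD_slice hV hI h0 sφ tφ hp,
      dirD_dirD_slice hV hI h0 sψ tψ hp, tφ p hp, InitialData.φzz, InitialData.Lφ,
      InitialData.Lψ, dx_eq_dirD, dy_eq_dirD]
  refine ⟨hV, hI, h0, hM, M, tφ, fun p hp => (htr p hp).2.1, zz, hh, hk, fun p hp => ?_⟩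
  have e := M.evolution (p, 0) ⟨hp, h0⟩
  rw [psiZZ, zz p hp] at e
  simp only [Dx_eq_dirD, Dy_eq_dirD, dirD_dirD_slice hV hI h0 sφ tφ hp,
    dirD_dirD_slice hV hI h0 M.smooth hh hp, dirD_slice hV tφ hp (hd sφ p hp),
    dirD_slice hV hh hp (hd M.smooth p hp), tφ p hp, hh p hp] at e
  exact e

namespace HasSlice

variable {V : Set (ℝ × ℝ)} {I : Set ℝ} {d : InitialData} {φ h : (ℝ × ℝ) × ℝ → ℝ}
  {h₀ k₀ : ℝ × ℝ → ℝ}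

theorem contDiffOn_tan (H : HasSlice V I d φ h h₀ k₀) :
    ContDiffOn ℝ ∞ (fun q => tan (φ q)) (V ×ˢ I) :=
  AnalyticOnNhd.contDiffOn_of_completeSpace fun q hq =>
    analyticAt_tan_comp (H.memMet.analytic q hq) (H.memMet.cos_ne q hq)

theorem contDiffOn_cot (H : HasSlice V I d φ h h₀ k₀) :
    ContDiffOn ℝ ∞ (fun q => cot (φ q)) (V ×ˢ I) :=
  AnalyticOnNhd.contDiffOn_of_completeSpace fun q hq =>
    analyticAt_cot_comp (H.memMet.analytic q hq) (H.memMet.sin_ne q hq)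

theorem z_derivative_y (H : HasSlice V I d φ h h₀ k₀) {p : ℝ × ℝ} (hp : p ∈ V) :
    dirD (0, 1) (barHZZ d h₀) p
      - (dirD (0, 1) k₀ p * d.φz p * cot (d.φ p) + dirD (0, 1) h₀ p * d.φzz p * cot (d.φ p)
        - dirD (0, 1) h₀ p * d.φz p * ((1 + cot (d.φ p) ^ 2) * d.φz p))
      + (k₀ p * dirD (0, 1) d.φz p * tan (d.φ p) + h₀ p * dirD (0, 1) d.φzz p * tan (d.φ p)
        + h₀ p * dirD (0, 1) d.φz p * ((1 + tan (d.φ p) ^ 2) * d.φz p)) = 0 := by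
  have hU : IsOpen (V ×ˢ I) := H.isOpen.prod H.isOpen_I
  have hq : (p, (0 : ℝ)) ∈ V ×ˢ I := ⟨hp, H.zero_mem⟩
  have dφ := (H.memMet.analytic _ hq).differentiableAt
  refine dirD_z_slice (w := dirD (0, 1) φ) (T₀ := fun p => tan (d.φ p))
    (C₀ := fun p => cot (d.φ p)) H.isOpen H.isOpen_I H.zero_mem (0, 1) H.memXi.smooth
    (contDiffOn_dirD hU H.memMet.analytic.contDiffOn_of_completeSpace _) H.contDiffOn_tan
    H.contDiffOn_cot (fun q hq => ?_) H.h_eq H.hz_eq H.hzz_eq H.φz_eq H.φzz_eq hp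
    (by rw [H.φ_eq p hp]) (by rw [H.φ_eq p hp]) ?_ ?_
  · exact H.memXi.eq_yz q hq
  · rw [dirD_tan _ dφ (H.memMet.cos_ne _ hq), H.φ_eq p hp, H.φz_eq p hp]
  · rw [dirD_cot _ dφ (H.memMet.sin_ne _ hq), H.φ_eq p hp, H.φz_eq p hp]

/-- The `(x, z)`-equation takes the shape of the `(y, z)`-equation when `φ_z` changes sign and
`tan`, `cot` are exchanged. It is stated in these variables to match the swapped data. -/
theorem z_derivative_x (H : HasSlice V I d φ h h₀ k₀) {p : ℝ × ℝ} (hp : p ∈ V) :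
    dirD (1, 0) (barHZZ d h₀) p
      - (dirD (1, 0) k₀ p * -d.φz p * tan (d.φ p) + dirD (1, 0) h₀ p * -d.φzz p * tan (d.φ p)
        - dirD (1, 0) h₀ p * -d.φz p * ((1 + tan (d.φ p) ^ 2) * -d.φz p))
      + (k₀ p * dirD (1, 0) (fun p => -d.φz p) p * cot (d.φ p)
        + h₀ p * dirD (1, 0) (fun p => -d.φzz p) p * cot (d.φ p)
        + h₀ p * dirD (1, 0) (fun p => -d.φz p) p * ((1 + cot (d.φ p) ^ 2) * -d.φz p)) = 0 := by
  have hU : IsOpen (V ×ˢ I) := H.isOpen.prod H.isOpen_I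
  have hq : (p, (0 : ℝ)) ∈ V ×ˢ I := ⟨hp, H.zero_mem⟩
  have dφ := (H.memMet.analytic _ hq).differentiableAt
  refine dirD_z_slice (w := fun q => -dirD (0, 1) φ q) (T₀ := fun p => cot (d.φ p))
    (C₀ := fun p => tan (d.φ p)) H.isOpen H.isOpen_I H.zero_mem (1, 0) H.memXi.smooth
    (contDiffOn_dirD hU H.memMet.analytic.contDiffOn_of_completeSpace _).neg H.contDiffOn_cot
    H.contDiffOn_tan (fun q hq => ?_) H.h_eq H.hz_eq H.hzz_eq
    (fun q hq => by rw [H.φz_eq q hq]) (fun q hq => by rw [dirD_neg, H.φzz_eq q hq]) hp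
    (by rw [H.φ_eq p hp]) (by rw [H.φ_eq p hp]) ?_ ?_
  · have e := H.memXi.eq_xz q hq
    rw [dirD_neg]
    simp only [Dx_eq_dirD, Dz_eq_dirD] at e
    change dirD ((1, 0), 0) (dirD (0, 1) h) q + dirD ((1, 0), 0) h q * dirD (0, 1) φ q * tan (φ q)
      - h q * dirD ((1, 0), 0) (dirD (0, 1) φ) q * cot (φ q) = 0 at e
    linear_combination e
  · rw [dirD_cot _ dφ (H.memMet.sin_ne _ hq), H.φ_eq p hp, H.φz_eq p hp]; ring
  · rw [dirD_tan _ dφ (H.memMet.cos_ne _ hq), H.φ_eq p hp, H.φz_eq p hp]; ring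

end HasSlice

/-! ### The two cases `κ̄₁ ≡ 0` and `κ̄₂ ≡ 0` -/

section Potential

variable {V : Set (ℝ × ℝ)} {E G : ℝ × ℝ → ℝ} {d : InitialData}

/-- The special choice of the integration constant makes `φ_zz` and `ψ_zz` explicit in `φ` and
`φ_z`, which is the form needed in `dirD_h_eq` and in the final contradiction. -/
theorem IsSpecialPotential.zz_of_y (H : IsDeterminedBy V E G d)
    (hψ : IsSpecialPotential V d) (hVo : IsOpen V) (hφ : ∀ p ∈ V, dirD (1, 0) d.φ p = 0)
    {p : ℝ × ℝ} (hp : p ∈ V) :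
    d.φzz p = -dirD (0, 1) (dirD (0, 1) d.φ) p + cot (d.φ p) * d.φz p ^ 2
      - tan (d.φ p) * dirD (0, 1) d.φ p ^ 2 ∧
    d.ψzz p = -(dirD (0, 1) (dirD (0, 1) d.φ) p * tan (d.φ p))
      - (1 / 2) * (d.φz p ^ 2 * (cot (d.φ p) ^ 2 - 1)
        - dirD (0, 1) d.φ p ^ 2 * (1 - tan (d.φ p) ^ 2)) := by
  have hc := H.cos_ne p hp
  have hs := H.sin_ne p hp
  have hTC := tan_mul_cot_eq_one hs hc
  have hT : tan (d.φ p) ≠ 0 := left_ne_zero_of_mul_eq_one hTC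
  have hC : cot (d.φ p) = (tan (d.φ p))⁻¹ := eq_inv_of_mul_eq_one_right hTC
  have hxx : dx (dx d.φ) p = 0 := by
    rw [dx_eq_dirD, dirD_congr hVo hφ (1, 0) hp, dirD_const]
  have hL : d.Lψ p = (1 / 2) * (d.φz p ^ 2 * (1 + cot (d.φ p) ^ 2)
      - dirD (0, 1) d.φ p ^ 2 * (1 + tan (d.φ p) ^ 2))
      - dirD (0, 1) (dirD (0, 1) d.φ) p * tan (d.φ p) := by
    rw [hψ.of_y hφ p hp, ← one_add_tan_sq hc, ← one_add_cot_sq hs, dy_eq_dirD]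
    ring
  have h2 : 1 + tan (d.φ p) ^ 2 ≠ 0 := by positivity
  simp only [InitialData.φzz, InitialData.ψzz, InitialData.Lφ, hL, hxx, dy_eq_dirD,
    cos_two_mul_eq_tan hc, sin_two_mul_eq_tan hc, hC]
  constructor <;> (field_simp; ring)

theorem IsSpecialPotential.zz_of_x (H : IsDeterminedBy V E G d)
    (hψ : IsSpecialPotential V d) (hVo : IsOpen V) (hφ : ∀ p ∈ V, dirD (0, 1) d.φ p = 0)
    {p : ℝ × ℝ} (hp : p ∈ V) :
    d.φzz p = -dirD (1, 0) (dirD (1, 0) d.φ) p - tan (d.φ p) * d.φz p ^ 2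
      + cot (d.φ p) * dirD (1, 0) d.φ p ^ 2 ∧
    d.ψzz p = dirD (1, 0) (dirD (1, 0) d.φ) p * cot (d.φ p)
      - (1 / 2) * (d.φz p ^ 2 * (tan (d.φ p) ^ 2 - 1)
        - dirD (1, 0) d.φ p ^ 2 * (1 - cot (d.φ p) ^ 2)) := by
  have hc := H.cos_ne p hp
  have hs := H.sin_ne p hp
  have hTC := tan_mul_cot_eq_one hs hc
  have hT : tan (d.φ p) ≠ 0 := left_ne_zero_of_mul_eq_one hTC
  have hC : cot (d.φ p) = (tan (d.φ p))⁻¹ := eq_inv_of_mul_eq_one_right hTC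
  have hyy : dy (dy d.φ) p = 0 := by
    rw [dy_eq_dirD, dirD_congr hVo hφ (0, 1) hp, dirD_const]
  have hL : d.Lψ p = -((1 / 2) * (d.φz p ^ 2 * (1 + tan (d.φ p) ^ 2)
      - dirD (1, 0) d.φ p ^ 2 * (1 + cot (d.φ p) ^ 2)))
      - dirD (1, 0) (dirD (1, 0) d.φ) p * cot (d.φ p) := by
    rw [hψ.of_x hφ p hp, ← one_add_tan_sq hc, ← one_add_cot_sq hs, dx_eq_dirD]
    ring
  have h2 : 1 + tan (d.φ p) ^ 2 ≠ 0 := by positivity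
  simp only [InitialData.φzz, InitialData.ψzz, InitialData.Lφ, hL, hyy, dx_eq_dirD,
    cos_two_mul_eq_tan hc, sin_two_mul_eq_tan hc, hC]
  constructor <;> (field_simp; ring)

end Potential

end GuichardNet

end

/-! ### Proof of the proposition -/

theorem proposition3p3
    (V : Set (ℝ × ℝ)) (hVo : IsOpen V) (hVc : IsConnected V)
    (E G : ℝ × ℝ → ℝ) (hEG : GuichardNet.MemMetZero V E G)
    (d : GuichardNet.InitialData) (hd : GuichardNet.ArisesFrom V E G d)
    (P Pz : ℝ × ℝ → ℝ) (hP : AnalyticOnNhd ℝ P V) (hPz : AnalyticOnNhd ℝ Pz V)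
    (hsol : GuichardNet.IsInitialSolution V d
      (GuichardNet.expNeg P) (GuichardNet.expNegZ P Pz))
    (hkappa : ∀ p ∈ V,
      GuichardNet.barKappa1 d (GuichardNet.expNeg P) (GuichardNet.expNegZ P Pz) p *
        GuichardNet.barKappa2 d (GuichardNet.expNeg P) (GuichardNet.expNegZ P Pz) p = 0) :
    (GuichardNet.IsSpecialY V E G d.φ d.φz ∨ GuichardNet.IsSpecialX V E G d.φ d.φz) ∧
    (GuichardNet.IsSpecialPotential V d →
      ∀ (V' : Set (ℝ × ℝ)) (I : Set ℝ), IsOpen V' → V'.Nonempty → V' ⊆ V →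
        IsOpen I → I.OrdConnected → (0 : ℝ) ∈ I →
        ∀ φ : (ℝ × ℝ) × ℝ → ℝ, GuichardNet.IsNetIssuingFrom V' I d φ →
          ¬ ∃ h : (ℝ × ℝ) × ℝ → ℝ, GuichardNet.MemXi (V' ×ˢ I) φ h ∧
            ∀ p ∈ V', h (p, 0) = Real.exp (-P p) ∧
              GuichardNet.Dz h (p, 0) = -(Real.exp (-P p) * Pz p)) := by
  open GuichardNet in
  have H := hd.1
  have D := H.determinedData hVo hEG.1
  have ah : AnalyticOnNhd ℝ (expNeg P) V := fun p hp => (hP p hp).neg.rexp'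
  have ak : AnalyticOnNhd ℝ (expNegZ P Pz) V := fun p hp => ((ah p hp).mul (hPz p hp)).neg
  have S := hsol.solvesInitialSystem H ah ak (fun p _ => Real.exp_pos _)
  have aκ := analyticOnNhd_dirKappa3 D S
  have hκ := eq_zero_or_eq_zero_of_analytic_mul hVo hVc.isPreconnected
    (fun p hp => ((ah p hp).mul (D.an_T p hp)).add (aκ p hp))
    (fun p hp => ((ah p hp).mul (D.an_C p hp)).neg.add (aκ p hp))
    (fun p hp => by
      have e := hkappa p hp
      rw [barKappa1, barKappa2, barKappa3_eq_dirKappa3 H _ _ hp] at e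
      exact e)
  rcases hκ with hκ | hκ
  · have hφ : ∀ p ∈ V, dirD (1, 0) d.φ p = 0 := fun p hp => dirD_φ_eq_zero D S hκ hp
    refine ⟨Or.inl (H.isSpecialY hVo hVc hEG.1 hφ), ?_⟩
    rintro hψ V' I hV' ⟨p₀, hp₀⟩ hsub hI - h0 φ N ⟨h, M, htr⟩
    have K := N.hasSlice (h₀ := expNeg P) (k₀ := expNegZ P Pz) hV' hI h0 M
      (fun p hp => (htr p hp).1) (fun p hp => (htr p hp).2)
    have hZW := fun p (hp : p ∈ V') => hψ.zz_of_y H hVo hφ (hsub hp)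
    have D' := D.mono hV' hsub
    have S' := S.mono hsub
    refine false_of_dirD_h_eq D' S' (fun p hp => hκ p (hsub hp)) (fun p hp => hφ p (hsub hp))
      (fun p hp => (hZW p hp).1) (fun p hp => (hZW p hp).2) (fun p hp => ?_) hp₀
    refine dirD_h_eq D' S' (fun p hp => hκ p (hsub hp)) (fun p hp => hφ p (hsub hp))
      (fun p hp => (hZW p hp).1) (fun p hp => (hZW p hp).2) hp ?_
    rw [← dirD_congr hV' (fun q hq => barHZZ_eq_dirHZZ H (expNeg P) (hsub hq)) (0, 1) hp]
    exact K.z_derivative_y hp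
  -- For the exchanged data the function `κ̄₁` equals `-κ̄₂`, so the first case applies to them.
  · have hκ' : ∀ p ∈ V, expNeg P p * cot (d.φ p) + dirKappa3 (0, 1) (1, 0) (fun p => -d.φ p)
        (fun p => -d.φz p) (fun p => cot (d.φ p)) (fun p => tan (d.φ p)) (fun p => -d.φzz p)
        (expNeg P) (expNegZ P Pz) p = 0 := fun p hp => by
      have e := hκ p hp
      simp only [Pi.add_apply, Pi.neg_apply, Pi.mul_apply] at e
      rw [dirKappa3_swap]
      linear_combination -e
    have hφ' : ∀ p ∈ V, dirD (0, 1) (fun p => -d.φ p) p = 0 := fun p hp =>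
      dirD_φ_eq_zero D.swap S.swap hκ' hp
    have hφ : ∀ p ∈ V, dirD (0, 1) d.φ p = 0 := fun p hp => by
      rw [← neg_eq_zero, ← dirD_neg]; exact hφ' p hp
    refine ⟨Or.inr (H.isSpecialX hVo hVc hEG.1 hφ), ?_⟩
    rintro hψ V' I hV' ⟨p₀, hp₀⟩ hsub hI - h0 φ N ⟨h, M, htr⟩
    have K := N.hasSlice (h₀ := expNeg P) (k₀ := expNegZ P Pz) hV' hI h0 M
      (fun p hp => (htr p hp).1) (fun p hp => (htr p hp).2)
    have hZW := fun p (hp : p ∈ V') => hψ.zz_of_x H hVo hφ (hsub hp)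
    have D' := D.swap.mono hV' hsub
    have S' := S.swap.mono hsub
    have hZ : ∀ p ∈ V', -d.φzz p = -dirD (1, 0) (dirD (1, 0) (fun p => -d.φ p)) p
        + tan (d.φ p) * (-d.φz p) ^ 2
        - cot (d.φ p) * dirD (1, 0) (fun p => -d.φ p) p ^ 2 := fun p hp => by
      simp only [dirD_neg_fun]; linear_combination -(hZW p hp).1
    have hW : ∀ p ∈ V', d.ψzz p = -(dirD (1, 0) (dirD (1, 0) (fun p => -d.φ p)) p * cot (d.φ p))
        - (1 / 2) * ((-d.φz p) ^ 2 * (tan (d.φ p) ^ 2 - 1)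
          - dirD (1, 0) (fun p => -d.φ p) p ^ 2 * (1 - cot (d.φ p) ^ 2)) := fun p hp => by
      simp only [dirD_neg_fun]; linear_combination (hZW p hp).2
    refine false_of_dirD_h_eq D' S' (fun p hp => hκ' p (hsub hp)) (fun p hp => hφ' p (hsub hp))
      hZ hW (fun p hp => ?_) hp₀
    refine dirD_h_eq D' S' (fun p hp => hκ' p (hsub hp)) (fun p hp => hφ' p (hsub hp)) hZ hW hp ?_
    rw [← dirD_congr hV' (fun q hq => (barHZZ_eq_dirHZZ H (expNeg P) (hsub hq)).trans
      (dirHZZ_swap _ _ _ _ _ _ _ _).symm) (1, 0) hp]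
    exact K.z_derivative_x hp
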